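/- For $n\ge 0$ let $\mathcal F_n$ be the set of sequences $f=(\tau_1,\dots,\tau_n)$ of transpositions of $\{0,1,\dots,n\}$ whose product, multiplied from left to right, is the full cycle $(0\,1\,\cdots\,n)$. Write $\tau_i=(a_i\,b_i)$ with $a_i<b_i$, and put $$\mathrm{area}_L(f)=\binom n2-\sum_{i=1}^n a_i,\qquad \mathrm{area}_U(f)=\sum_{i=1}^n b_i-\binom n2 .$$ Then $\mathrm{area}_L(f)\ge 0$ and $\mathrm{area}_U(f)\ge 0$ for all $n\ge 0$ and all $f\in\mathcal F_n$. Moreover, the polynomials $F_n(q,t)=\sum_{f\in\mathcal F_n} q^{\mathrm{area}_L(f)}t^{\mathrm{area}_U(f)}$ and their exponential generating series $F(x;q,t)=\sum_{n\ge 0}F_n(q,t)\,\frac{x^n}{n!}$ satisfy, as formal power series in $x$ over $\mathbb Q[q,t]$, $$F(x;q,t)=\exp\Bigl(t\sum_{n\ge 1}\bigl(t^{n-1}+t^{n-2}q+\cdots+q^{n-1}\bigr)F_{n-1}(q,t)\,\frac{x^n}{n!}\Bigr).$$ -/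

import Mathlib

namespace MinFact

/-- The canonical full cycle `(0 1 ⋯ n)` on `{0, 1, …, n}`, i.e. `i ↦ i + 1` and `n ↦ 0`. -/
def canonicalCycle (n : ℕ) : Equiv.Perm (Fin (n + 1)) := finRotate (n + 1)

/-- The product `τ₁ τ₂ ⋯ τₘ` multiplied from left to right: `i ↦ τₘ(⋯ τ₂(τ₁(i)) ⋯)`.
Mathlib composes permutations from right to left, whence the reversal. -/
def leftToRightProd {n m : ℕ} (τ : Fin m → Equiv.Perm (Fin (n + 1))) : Equiv.Perm (Fin (n + 1)) :=
  (List.ofFn τ).reverse.prod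

open Classical in
/-- The set of minimal factorizations of `(0 1 ⋯ n)`: sequences of `n` transpositions of
`{0, …, n}` whose left-to-right product is `(0 1 ⋯ n)`. -/
noncomputable def minimalFactorizations (n : ℕ) : Finset (Fin n → Equiv.Perm (Fin (n + 1))) :=
  {τ | (∀ i, (τ i).IsSwap) ∧ leftToRightProd τ = canonicalCycle n}

/-- The smaller element `a` moved by a transposition `(a b)`, `a < b`. -/
noncomputable def lower {n : ℕ} (π : Equiv.Perm (Fin (n + 1))) : Fin (n + 1) := π.support.inf id

/-- The larger element `b` moved by a transposition `(a b)`, `a < b`. -/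
noncomputable def upper {n : ℕ} (π : Equiv.Perm (Fin (n + 1))) : Fin (n + 1) := π.support.sup id

theorem lower_swap {n : ℕ} {a b : Fin (n + 1)} (h : a < b) : lower (Equiv.swap a b) = a := by
  simp [lower, Equiv.Perm.support_swap h.ne, h.le]

theorem upper_swap {n : ℕ} {a b : Fin (n + 1)} (h : a < b) : upper (Equiv.swap a b) = b := by
  simp [upper, Equiv.Perm.support_swap h.ne, h.le]

/-- The lower area `C(n,2) - (a₁ + ⋯ + aₙ)`, as an integer. -/
noncomputable def areaL {n : ℕ} (τ : Fin n → Equiv.Perm (Fin (n + 1))) : ℤ :=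
  (n.choose 2 : ℤ) - ∑ i, ((lower (τ i) : ℕ) : ℤ)

/-- The upper area `(b₁ + ⋯ + bₙ) - C(n,2)`, as an integer. -/
noncomputable def areaU {n : ℕ} (τ : Fin n → Equiv.Perm (Fin (n + 1))) : ℤ :=
  ∑ i, ((upper (τ i) : ℕ) : ℤ) - (n.choose 2 : ℤ)

/-- The polynomial ring `ℚ[q, t]`. -/
abbrev Coeff : Type := MvPolynomial (Fin 2) ℚ

/-- The indeterminate `q`. -/
noncomputable def q : Coeff := MvPolynomial.X 0

/-- The indeterminate `t`. -/
noncomputable def t : Coeff := MvPolynomial.X 1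

/-- `F_n(q,t) = ∑ q^{area_L(f)} t^{area_U(f)}` over the minimal factorizations `f` of `(0 1 ⋯ n)`.
The main theorem also asserts that the exponents are nonnegative, so `Int.toNat` loses nothing. -/
noncomputable def F (n : ℕ) : Coeff :=
  ∑ f ∈ minimalFactorizations n, q ^ (areaL f).toNat * t ^ (areaU f).toNat

/-- `t^{n-1} + t^{n-2} q + ⋯ + q^{n-1}`, which is the empty sum `0` for `n = 0`. -/
noncomputable def qtNumber (n : ℕ) : Coeff :=
  ∑ i ∈ Finset.range n, t ^ (n - 1 - i) * q ^ i

/-- The exponential generating series `∑_{n ≥ 0} a_n xⁿ / n!`. -/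
noncomputable def egf (a : ℕ → Coeff) : PowerSeries Coeff :=
  PowerSeries.mk fun n => (1 / (n.factorial : ℚ)) • a n

/-- The series `t ∑_{n ≥ 1} (t^{n-1} + t^{n-2} q + ⋯ + q^{n-1}) F_{n-1}(q,t) xⁿ / n!`.
The term `n = 0` is zero because `qtNumber 0 = 0`. -/
noncomputable def exponent : PowerSeries Coeff :=
  PowerSeries.C t * egf fun n => qtNumber n * F (n - 1)

/-- The exponent has zero constant term, so it may be substituted into the exponential series. -/
theorem hasSubst_exponent : PowerSeries.HasSubst exponent := by
  apply PowerSeries.HasSubst.of_constantCoeff_zero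
  change PowerSeries.constantCoeff exponent = 0
  simp [exponent, egf, qtNumber]

end MinFact

/-! Follow the largest point `N + 1` through the successive transpositions of a factorization in
`Fact (N + 1)`. It ends at `0`, and by `trajectory` it only ever jumps down, so its jump sizes add
up to `N + 1`. Hence `(N + 1) * F (N + 1)` counts factorizations with one marked jump, each weighted
by the size of that jump (`sum_jumps`). A jump along the arc `(u, u + k + 1)` splits the
factorization into a factorization of a cycle on `k + 1` points and one on `N - k + 1` points
(`exists_assemble`, `Fact.assemble`). The point `u` is forced: it is the current position of the
largest point in the large factor. What remains free is how the two lists of arcs are interleaved.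
If `i` small arcs precede the jump and `j` follow it, with `i + j = k`, then the areas add up with
an excess of `i` in the lower area and `j + 1` in the upper area (`area_assemble`). Nonnegativity of
both areas follows by induction. For given `i` and `j` there are `(N + 1).choose (k + 1)`
interleavings (`sum_bools_bools_count`), and each jump counts `k + 1` times. Since `(k + 1) * (N +
1).choose (k + 1) = (N + 1) * N.choose k`, cancelling `N + 1` gives the recursion `F_succ`. For
generating series it says that the derivative of `egf F` is `egf F` times the derivative of
`exponent`, and the constant term `1` then determines the exponential. -/

namespace MinFact

/-! ### Transpositions as arcs acting on the natural numbers -/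

/-- The image of `x` under the transposition of the endpoints of the arc `e`. -/
def hop (e : ℕ × ℕ) (x : ℕ) : ℕ := if x = e.1 then e.2 else if x = e.2 then e.1 else x

/-- The image of `x` under the left-to-right product of the transpositions in `L`. -/
def run : List (ℕ × ℕ) → ℕ → ℕ
  | [], x => x
  | e :: L, x => run L (hop e x)

/-- The cycle `(0 1 ⋯ n)` as a function on `ℕ`, meaningful on `{0, …, n}`. -/
def cyc (n x : ℕ) : ℕ := if x < n then x + 1 else 0

/-- The list of arcs `L` is a minimal factorization of `(0 1 ⋯ n)`. -/
structure Fact (n : ℕ) (L : List (ℕ × ℕ)) : Prop where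
  length_eq : L.length = n
  valid : ∀ e ∈ L, e.1 < e.2 ∧ e.2 ≤ n
  run_eq : ∀ x ≤ n, run L x = cyc n x

@[simp] theorem run_nil (x : ℕ) : run [] x = x := rfl

@[simp] theorem run_cons (e : ℕ × ℕ) (L : List (ℕ × ℕ)) (x : ℕ) :
    run (e :: L) x = run L (hop e x) := rfl

theorem run_append (A B : List (ℕ × ℕ)) (x : ℕ) : run (A ++ B) x = run B (run A x) := by
  induction A generalizing x with
  | nil => rfl
  | cons e A ih => simp [ih]

theorem hop_hop (e : ℕ × ℕ) (x : ℕ) : hop e (hop e x) = x := by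
  unfold hop; split_ifs <;> omega

theorem run_reverse_run (L : List (ℕ × ℕ)) (x : ℕ) : run L.reverse (run L x) = x := by
  induction L generalizing x with
  | nil => rfl
  | cons e L ih => simp [run_append, ih, hop_hop]

theorem run_injective (L : List (ℕ × ℕ)) : Function.Injective (run L) :=
  Function.LeftInverse.injective (run_reverse_run L)

theorem run_run_reverse (L : List (ℕ × ℕ)) (x : ℕ) : run L (run L.reverse x) = x := by
  simpa using run_reverse_run L.reverse x

theorem hop_le {n : ℕ} {e : ℕ × ℕ} (he : e.1 < e.2 ∧ e.2 ≤ n) {x : ℕ} (hx : x ≤ n) :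
    hop e x ≤ n := by
  unfold hop; split_ifs <;> omega

theorem run_le {n : ℕ} {L : List (ℕ × ℕ)} (hL : ∀ e ∈ L, e.1 < e.2 ∧ e.2 ≤ n) {x : ℕ}
    (hx : x ≤ n) : run L x ≤ n := by
  induction L generalizing x with
  | nil => exact hx
  | cons e L ih =>
    exact ih (fun e' h => hL e' (List.mem_cons_of_mem _ h)) (hop_le (hL e (by simp)) hx)

/-! ### Connectivity -/

/-- A list of `k` arcs on `{0, …, n}` has at least `n + 1 - k` connected components. -/
theorem exists_classes (n : ℕ) (L : List (ℕ × ℕ)) :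
    ∃ ρ : ℕ → ℕ, (∀ e ∈ L, ρ e.1 = ρ e.2) ∧
      n + 1 ≤ ((Finset.range (n + 1)).image ρ).card + L.length := by
  induction L with
  | nil => exact ⟨id, by simp, by simp⟩
  | cons e L ih =>
    obtain ⟨ρ, h1, h2⟩ := ih
    refine ⟨fun x => if ρ x = ρ e.2 then ρ e.1 else ρ x, ?_, ?_⟩
    · intro e' he'
      rcases List.mem_cons.1 he' with rfl | he'
      · simp
      · simp [h1 e' he']
    -- Merging the classes of the two ends can only make the label `ρ e.2` disappear.
    · have : (Finset.range (n + 1)).image ρ ⊆ insert (ρ e.2)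
          ((Finset.range (n + 1)).image fun x => if ρ x = ρ e.2 then ρ e.1 else ρ x) := by
        intro y hy
        obtain ⟨x, hx, rfl⟩ := Finset.mem_image.1 hy
        by_cases h : ρ x = ρ e.2
        · simp [h]
        · exact Finset.mem_insert_of_mem (Finset.mem_image.2 ⟨x, hx, by simp [h]⟩)
      have h3 := (Finset.card_le_card this).trans (Finset.card_insert_le _ _)
      simp only [List.length_cons]
      omega

theorem apply_run_of_const {ρ : ℕ → ℕ} {L : List (ℕ × ℕ)} (h : ∀ e ∈ L, ρ e.1 = ρ e.2) (x : ℕ) :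
    ρ (run L x) = ρ x := by
  induction L generalizing x with
  | nil => rfl
  | cons e L ih =>
    rw [run_cons, ih fun e' he' => h e' (List.mem_cons_of_mem _ he')]
    have := h e (by simp)
    unfold hop
    split_ifs with h1 h2 <;> simp_all

theorem card_image_le_one_of_const {ρ : ℕ → ℕ} {n : ℕ} (h : ∀ x ≤ n, ρ x = ρ 0) :
    ((Finset.range (n + 1)).image ρ).card ≤ 1 := by
  refine (Finset.card_le_card (t := {ρ 0}) ?_).trans (by simp)
  intro y hy
  obtain ⟨x, hx, rfl⟩ := Finset.mem_image.1 hy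
  simp [h x (by simpa [Nat.lt_succ_iff] using hx)]

/-- The cycle is transitive, so a labelling of the components is constant, and connecting `n + 1`
points takes `n` arcs. This lower bound later forces the lengths of both factors of a split
factorization. -/
theorem le_length_of_run_eq {n : ℕ} {L : List (ℕ × ℕ)} (h : ∀ x ≤ n, run L x = cyc n x) :
    n ≤ L.length := by
  obtain ⟨ρ, h1, h2⟩ := exists_classes n L
  have hc : ∀ x ≤ n, ρ x = ρ 0 := by
    intro x hx
    induction x with
    | zero => rfl
    | succ x ih =>
      rw [← ih (by omega), ← apply_run_of_const h1 x, h x (by omega)]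
      simp [cyc, show x < n by omega]
  have := card_image_le_one_of_const hc
  omega

/-- In a minimal factorization starting with `(u v)`, no other arc joins `(u, v]` to its
complement. -/
theorem Fact.not_cross {n u v : ℕ} {L : List (ℕ × ℕ)} (h : Fact n ((u, v) :: L)) :
    ∀ e ∈ L, (u < e.1 ∧ e.1 ≤ v ↔ u < e.2 ∧ e.2 ≤ v) := by
  obtain ⟨ρ, h1, h2⟩ := exists_classes n L
  have huv := h.valid (u, v) (by simp)
  have hlen := h.length_eq
  simp only [List.length_cons] at hlen huv
  -- Component labels are constant on the orbits of the product of `L`. That product is the full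
  -- cycle with `(u v)` removed in front, and its orbits are `(u, v]` and the complement.
  have key : ∀ x ≤ n, ρ (hop (u, v) x) = ρ (cyc n x) := fun x hx => by
    rw [← h.run_eq x hx, run_cons, apply_run_of_const h1]
  have hin : ∀ k, u + 1 + k ≤ v → ρ (u + 1 + k) = ρ v := by
    intro k
    induction k with
    | zero =>
      intro hk
      have := key u (by omega)
      simpa [hop, cyc, show u < n by omega] using this.symm
    | succ k ih =>
      intro hk
      have := key (u + 1 + k) (by omega)
      rw [← ih (by omega)]
      simp only [hop, cyc] at this
      rw [if_neg (by omega), if_neg (by omega), if_pos (by omega)] at this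
      exact this.symm
  have hlow : ∀ x ≤ u, ρ x = ρ 0 := by
    intro x hx
    induction x with
    | zero => rfl
    | succ x ih =>
      have := key x (by omega)
      rw [← ih (by omega)]
      simp only [hop, cyc] at this
      rw [if_neg (by omega), if_neg (by omega), if_pos (by omega)] at this
      exact this.symm
  have hhigh : ∀ k, v + 1 + k ≤ n → ρ (v + 1 + k) = ρ 0 := by
    intro k
    induction k with
    | zero =>
      intro hk
      have := key v (by omega)
      simp only [hop, cyc] at this
      rw [if_neg (by omega), if_pos trivial, if_pos (by omega), hlow u le_rfl] at this
      exact this.symm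
    | succ k ih =>
      intro hk
      have := key (v + 1 + k) (by omega)
      rw [← ih (by omega)]
      simp only [hop, cyc] at this
      rw [if_neg (by omega), if_neg (by omega), if_pos (by omega)] at this
      exact this.symm
  have hin' : ∀ x, u < x ∧ x ≤ v → ρ x = ρ v := fun x hx => by
    simpa [show u + 1 + (x - (u + 1)) = x by omega] using hin (x - (u + 1)) (by omega)
  have hout : ∀ x ≤ n, ¬ (u < x ∧ x ≤ v) → ρ x = ρ 0 := fun x hx hx' => by
    by_cases hxu : x ≤ u
    · exact hlow x hxu
    · simpa [show v + 1 + (x - (v + 1)) = x by omega] using hhigh (x - (v + 1)) (by omega)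
  -- `L` has only `n - 1` arcs, hence at least two components, so the two orbits carry different
  -- labels.
  have hne : ρ v ≠ ρ 0 := by
    intro hv
    have : ∀ x ≤ n, ρ x = ρ 0 := fun x hx => by
      by_cases hx' : u < x ∧ x ≤ v
      · rw [hin' x hx', hv]
      · exact hout x hx hx'
    have := card_image_le_one_of_const this
    omega
  intro e he
  have hv := h.valid e (by simp [he])
  have heq := h1 e he
  constructor
  · intro h3
    by_contra h4
    rw [hin' _ h3, hout _ hv.2 h4] at heq
    exact hne heq
  · intro h3
    by_contra h4
    rw [hin' _ h3, hout _ (by omega) h4] at heq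
    exact hne heq.symm

/-! ### Rotation -/

/-- Conjugation of the arc `e` by the cycle `(0 1 ⋯ n)`. -/
def rotUp (n : ℕ) (e : ℕ × ℕ) : ℕ × ℕ := if e.2 < n then (e.1 + 1, e.2 + 1) else (0, e.1 + 1)

/-- The inverse of `rotUp n`. -/
def rotDown (n : ℕ) (e : ℕ × ℕ) : ℕ × ℕ := if 0 < e.1 then (e.1 - 1, e.2 - 1) else (e.2 - 1, n)

theorem rotUp_valid {n : ℕ} {e : ℕ × ℕ} (he : e.1 < e.2 ∧ e.2 ≤ n) :
    (rotUp n e).1 < (rotUp n e).2 ∧ (rotUp n e).2 ≤ n := by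
  unfold rotUp; split_ifs <;> simp <;> omega

theorem rotDown_valid {n : ℕ} {e : ℕ × ℕ} (he : e.1 < e.2 ∧ e.2 ≤ n) :
    (rotDown n e).1 < (rotDown n e).2 ∧ (rotDown n e).2 ≤ n := by
  unfold rotDown; split_ifs <;> simp <;> omega

theorem rotUp_rotDown {n : ℕ} {e : ℕ × ℕ} (he : e.1 < e.2 ∧ e.2 ≤ n) :
    rotUp n (rotDown n e) = e := by
  obtain ⟨a, b⟩ := e
  simp only at he
  unfold rotDown; split_ifs with h <;> simp only [rotUp] at * <;> split_ifs <;>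
    simp only [Prod.mk.injEq] <;> omega

theorem rotDown_rotUp {n : ℕ} {e : ℕ × ℕ} (he : e.1 < e.2 ∧ e.2 ≤ n) :
    rotDown n (rotUp n e) = e := by
  obtain ⟨a, b⟩ := e
  simp only at he
  unfold rotUp; split_ifs with h <;> simp only [rotDown] at * <;> split_ifs <;>
    simp only [Prod.mk.injEq] <;> omega

theorem hop_rotUp {n : ℕ} {e : ℕ × ℕ} (he : e.1 < e.2 ∧ e.2 ≤ n) {x : ℕ} (hx : x ≤ n) :
    hop (rotUp n e) (cyc n x) = cyc n (hop e x) := by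
  obtain ⟨a, b⟩ := e
  simp only at he
  simp only [hop, cyc, rotUp]
  grind

theorem run_map_rotUp {n : ℕ} {L : List (ℕ × ℕ)} (hL : ∀ e ∈ L, e.1 < e.2 ∧ e.2 ≤ n) {x : ℕ}
    (hx : x ≤ n) : run (L.map (rotUp n)) (cyc n x) = cyc n (run L x) := by
  induction L generalizing x with
  | nil => rfl
  | cons e L ih =>
    have he := hL e (by simp)
    rw [List.map_cons, run_cons, run_cons, hop_rotUp he hx,
      ih (fun e' h => hL e' (List.mem_cons_of_mem _ h)) (hop_le he hx)]

/-- With left-to-right products, `A B = c` is equivalent to `B (c⁻¹ A c) = c`, and `rotUp` is this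
conjugation. It lets any chosen arc be moved to the front. -/
theorem fact_rotate_iff {n : ℕ} {A B : List (ℕ × ℕ)} (hA : ∀ e ∈ A, e.1 < e.2 ∧ e.2 ≤ n) :
    Fact n (A ++ B) ↔ Fact n (B ++ A.map (rotUp n)) := by
  constructor
  · intro h
    refine ⟨by have := h.length_eq; simp at this ⊢; omega, ?_, ?_⟩
    · intro e he
      rcases List.mem_append.1 he with he | he
      · exact h.valid e (by simp [he])
      · obtain ⟨e', he', rfl⟩ := List.mem_map.1 he
        exact rotUp_valid (hA e' he')
    · intro x hx
      have hy : run A.reverse x ≤ n := run_le (by simpa using fun a b h => hA (a, b) h) hx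
      have := h.run_eq _ hy
      rw [run_append, run_run_reverse] at this
      rw [run_append, this, run_map_rotUp hA hy, run_run_reverse]
  · intro h
    refine ⟨by have := h.length_eq; simp at this ⊢; omega, ?_, ?_⟩
    · intro e he
      rcases List.mem_append.1 he with he | he
      · exact hA e he
      · exact h.valid e (by simp [he])
    · intro x hx
      have := h.run_eq _ (run_le hA hx)
      rw [run_append, ← run_map_rotUp hA hx] at this
      rw [run_append, run_injective _ this]

/-! ### Tagged lists -/

/-- The left-tagged entries of a list. -/
def lefts {α β : Type*} : List (α ⊕ β) → List α
  | [] => []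
  | .inl a :: T => a :: lefts T
  | .inr _ :: T => lefts T

/-- The right-tagged entries of a list. -/
def rights {α β : Type*} : List (α ⊕ β) → List β
  | [] => []
  | .inl _ :: T => rights T
  | .inr b :: T => b :: rights T

section
variable {α β : Type*}

@[simp] theorem lefts_nil : lefts ([] : List (α ⊕ β)) = [] := rfl
@[simp] theorem rights_nil : rights ([] : List (α ⊕ β)) = [] := rfl
@[simp] theorem lefts_inl (a : α) (T : List (α ⊕ β)) : lefts (.inl a :: T) = a :: lefts T := rfl
@[simp] theorem lefts_inr (b : β) (T : List (α ⊕ β)) : lefts (.inr b :: T) = lefts T := rfl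
@[simp] theorem rights_inl (a : α) (T : List (α ⊕ β)) : rights (.inl a :: T) = rights T := rfl
@[simp] theorem rights_inr (b : β) (T : List (α ⊕ β)) : rights (.inr b :: T) = b :: rights T := rfl

@[simp] theorem lefts_append (S T : List (α ⊕ β)) : lefts (S ++ T) = lefts S ++ lefts T := by
  induction S with
  | nil => rfl
  | cons e S ih => cases e <;> simp [ih]

@[simp] theorem rights_append (S T : List (α ⊕ β)) : rights (S ++ T) = rights S ++ rights T := by
  induction S with
  | nil => rfl
  | cons e S ih => cases e <;> simp [ih]

@[simp] theorem mem_lefts {T : List (α ⊕ β)} {a : α} : a ∈ lefts T ↔ .inl a ∈ T := by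
  induction T with
  | nil => simp
  | cons e S ih => cases e <;> simp [ih]

@[simp] theorem mem_rights {T : List (α ⊕ β)} {b : β} : b ∈ rights T ↔ .inr b ∈ T := by
  induction T with
  | nil => simp
  | cons e S ih => cases e <;> simp [ih]

theorem length_lefts_add_length_rights (T : List (α ⊕ β)) :
    (lefts T).length + (rights T).length = T.length := by
  induction T with
  | nil => rfl
  | cons e S ih => cases e <;> simp <;> omega

theorem lefts_map_sumMap {γ δ : Type*} (f : α → γ) (g : β → δ) (T : List (α ⊕ β)) :
    lefts (T.map (Sum.map f g)) = (lefts T).map f := by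
  induction T with
  | nil => rfl
  | cons e S ih => cases e <;> simp [ih]

theorem rights_map_sumMap {γ δ : Type*} (f : α → γ) (g : β → δ) (T : List (α ⊕ β)) :
    rights (T.map (Sum.map f g)) = (rights T).map g := by
  induction T with
  | nil => rfl
  | cons e S ih => cases e <;> simp [ih]

end

/-! ### Splitting off the first arc -/

/-- Opens a gap of `m` points to the right of `u`. -/
def gapR (u m x : ℕ) : ℕ := if x ≤ u then x else x + m

/-- Opens a gap of `m` points to the left of `u`. -/
def gapL (u m x : ℕ) : ℕ := if x < u then x else x + m

/-- Places left-tagged arcs in `(u, u + m]`, right-tagged arcs in the complement. -/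
def placeR (u m : ℕ) : (ℕ × ℕ) ⊕ (ℕ × ℕ) → ℕ × ℕ
  | .inl e => (e.1 + (u + 1), e.2 + (u + 1))
  | .inr e => (gapR u m e.1, gapR u m e.2)

/-- Places left-tagged arcs in `[u, u + m)`, right-tagged arcs in the complement. -/
def placeL (u m : ℕ) : (ℕ × ℕ) ⊕ (ℕ × ℕ) → ℕ × ℕ
  | .inl e => (e.1 + u, e.2 + u)
  | .inr e => (gapL u m e.1, gapL u m e.2)

theorem run_map_placeR_inside {u m k : ℕ} (hm : k + 1 = m) {T : List ((ℕ × ℕ) ⊕ (ℕ × ℕ))}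
    (hT : ∀ e ∈ lefts T, e.1 < e.2 ∧ e.2 ≤ k) {x : ℕ} (hx : x ≤ k) :
    run (T.map (placeR u m)) (x + (u + 1)) = run (lefts T) x + (u + 1) := by
  induction T generalizing x with
  | nil => rfl
  | cons e T ih =>
    cases e with
    | inl e =>
      have he := hT e (by simp)
      rw [lefts_inl, List.map_cons, run_cons, run_cons,
        ← ih (fun e' h => hT e' (by simp at h ⊢; exact Or.inr h)) (hop_le he hx)]
      congr 1
      simp only [hop, placeR]
      grind
    | inr e =>
      rw [lefts_inr, List.map_cons, run_cons, ← ih hT hx]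
      congr 1
      simp only [hop, placeR, gapR]
      split_ifs <;> omega

theorem run_map_placeR_outside {u m k : ℕ} (hm : k + 1 = m) {T : List ((ℕ × ℕ) ⊕ (ℕ × ℕ))}
    (hT : ∀ e ∈ lefts T, e.1 < e.2 ∧ e.2 ≤ k) (x : ℕ) :
    run (T.map (placeR u m)) (gapR u m x) = gapR u m (run (rights T) x) := by
  induction T generalizing x with
  | nil => rfl
  | cons e T ih =>
    cases e with
    | inl e =>
      have he := hT e (by simp)
      rw [rights_inl, List.map_cons, run_cons,
        ← ih (fun e' h => hT e' (by simp at h ⊢; exact Or.inr h))]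
      congr 1
      simp only [hop, placeR, gapR]
      split_ifs <;> omega
    | inr e =>
      rw [rights_inr, List.map_cons, run_cons, run_cons, ← ih hT]
      congr 1
      simp only [hop, placeR, gapR]
      grind

theorem run_map_placeL_outside {u m k : ℕ} (hm : k + 1 = m) {T : List ((ℕ × ℕ) ⊕ (ℕ × ℕ))}
    (hT : ∀ e ∈ lefts T, e.1 < e.2 ∧ e.2 ≤ k) (x : ℕ) :
    run (T.map (placeL u m)) (gapL u m x) = gapL u m (run (rights T) x) := by
  induction T generalizing x with
  | nil => rfl
  | cons e T ih =>
    cases e with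
    | inl e =>
      have he := hT e (by simp)
      rw [rights_inl, List.map_cons, run_cons,
        ← ih (fun e' h => hT e' (by simp at h ⊢; exact Or.inr h))]
      congr 1
      simp only [hop, placeL, gapL]
      split_ifs <;> omega
    | inr e =>
      rw [rights_inr, List.map_cons, run_cons, run_cons, ← ih hT]
      congr 1
      simp only [hop, placeL, gapL]
      grind

/-- Multiplying by a transposition that meets both of two disjoint cycles joins them into one; here
the cycles live on `(u, u + m]` and on its complement. -/
theorem Fact.cons_placeR {n k m u : ℕ} (hm : k + 1 = m) (hu : u ≤ n)
    {T : List ((ℕ × ℕ) ⊕ (ℕ × ℕ))} (hl : Fact k (lefts T)) (hr : Fact n (rights T)) :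
    Fact (n + m) ((u, u + m) :: T.map (placeR u m)) := by
  refine ⟨?_, ?_, ?_⟩
  · have := length_lefts_add_length_rights T
    rw [hl.length_eq, hr.length_eq] at this
    simp; omega
  · intro e he
    rcases List.mem_cons.1 he with rfl | he
    · simp; omega
    · obtain ⟨e', he', rfl⟩ := List.mem_map.1 he
      cases e' with
      | inl e' =>
        have := hl.valid e' (by simpa)
        simp [placeR]; omega
      | inr e' =>
        have := hr.valid e' (by simpa)
        simp only [placeR, gapR]
        split_ifs <;> omega
  · intro x hx
    rw [run_cons]
    have hin : ∀ y ≤ k, run (T.map (placeR u m)) (y + (u + 1)) = cyc k y + (u + 1) := fun y hy => by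
      rw [run_map_placeR_inside hm hl.valid hy, hl.run_eq y hy]
    have hout : ∀ y ≤ n, run (T.map (placeR u m)) (gapR u m y) = gapR u m (cyc n y) :=
      fun y hy => by rw [run_map_placeR_outside hm hl.valid, hr.run_eq y hy]
    by_cases h1 : x = u
    · have := hin k le_rfl
      rw [show hop (u, u + m) x = k + (u + 1) by simp only [hop]; split_ifs; omega, this]
      simp only [cyc]; split_ifs <;> omega
    by_cases h2 : x = u + m
    · have := hout u hu
      rw [show hop (u, u + m) x = gapR u m u by simp only [hop, gapR]; split_ifs <;> omega, this]
      simp only [cyc, gapR]; split_ifs <;> omega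
    rw [show hop (u, u + m) x = x by simp [hop, h1, h2]]
    by_cases h3 : x < u
    · have := hout x (by omega)
      rw [show gapR u m x = x by simp [gapR]; omega] at this
      rw [this]
      simp only [cyc, gapR]; split_ifs <;> omega
    by_cases h4 : x < u + m
    · have := hin (x - (u + 1)) (by omega)
      rw [show x - (u + 1) + (u + 1) = x by omega] at this
      rw [this]
      simp only [cyc]; split_ifs <;> omega
    · have := hout (x - m) (by omega)
      rw [show gapR u m (x - m) = x by simp only [gapR]; split_ifs <;> omega] at this
      rw [this]
      simp only [cyc, gapR]; split_ifs <;> omega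

/-- The partial inverse of `placeR u m`. -/
def unplaceR (u m : ℕ) (e : ℕ × ℕ) : (ℕ × ℕ) ⊕ (ℕ × ℕ) :=
  if u < e.1 ∧ e.1 ≤ u + m then .inl (e.1 - (u + 1), e.2 - (u + 1))
  else .inr (if e.1 ≤ u then e.1 else e.1 - m, if e.2 ≤ u then e.2 else e.2 - m)

/-- By `Fact.not_cross`, every other arc lies inside `(u, v]` or inside its complement. Tagging it
accordingly and closing the gaps gives the two factors. -/
theorem exists_placeR_of_fact_cons {N u v : ℕ} {L : List (ℕ × ℕ)} (h : Fact N ((u, v) :: L)) :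
    ∃ n k m T, k + 1 = m ∧ v = u + m ∧ N = n + m ∧ u ≤ n ∧ L = T.map (placeR u m) ∧
      Fact k (lefts T) ∧ Fact n (rights T) := by
  have huv := h.valid (u, v) (by simp)
  simp only at huv
  obtain ⟨k, rfl⟩ : ∃ k, v = u + (k + 1) := ⟨v - u - 1, by omega⟩
  obtain ⟨n, rfl⟩ : ∃ n, N = n + (k + 1) := ⟨N - (k + 1), by omega⟩
  have hu : u ≤ n := by omega
  have hc := h.not_cross
  have hv : ∀ e ∈ L, e.1 < e.2 ∧ e.2 ≤ n + (k + 1) := fun e he => h.valid e (by simp [he])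
  set m := k + 1 with hm
  set T := L.map (unplaceR u m) with hTdef
  have hT : L = T.map (placeR u m) := by
    rw [hTdef, List.map_map]
    conv_lhs => rw [← List.map_id L]
    refine List.map_congr_left fun e he => ?_
    have h1 := hc e he
    have h2 := hv e he
    obtain ⟨a, b⟩ := e
    simp only at h1 h2
    simp only [Function.comp, unplaceR, id]
    split_ifs <;> simp only [placeR, gapR, Prod.mk.injEq]
    · omega
    all_goals constructor <;> split_ifs <;> omega
  have hl : ∀ e ∈ lefts T, e.1 < e.2 ∧ e.2 ≤ k := by
    intro e he
    rw [mem_lefts, hTdef, List.mem_map] at he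
    obtain ⟨e', he', h3⟩ := he
    have h1 := hc e' he'
    have h2 := hv e' he'
    unfold unplaceR at h3
    split_ifs at h3
    simp only [Sum.inl.injEq] at h3
    subst h3
    simp only
    omega
  have hr : ∀ e ∈ rights T, e.1 < e.2 ∧ e.2 ≤ n := by
    intro e he
    rw [mem_rights, hTdef, List.mem_map] at he
    obtain ⟨e', he', h3⟩ := he
    have h1 := hc e' he'
    have h2 := hv e' he'
    unfold unplaceR at h3
    split_ifs at h3
    all_goals
      simp only [Sum.inr.injEq] at h3
      subst h3
      simp only
      omega
  have hrun : ∀ x ≤ n + m, run L (hop (u, u + m) x) = cyc (n + m) x := fun x hx => h.run_eq x hx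
  have hlrun : ∀ x ≤ k, run (lefts T) x = cyc k x := by
    intro x hx
    have h1 := run_map_placeR_inside (u := u) hm hl hx
    rw [← hT] at h1
    by_cases hxk : x = k
    · have h2 := hrun u (by omega)
      rw [show hop (u, u + m) u = x + (u + 1) by simp [hop]; omega, h1] at h2
      simp only [cyc] at h2 ⊢; split_ifs at h2 ⊢ <;> omega
    · have h2 := hrun (x + (u + 1)) (by omega)
      rw [show hop (u, u + m) (x + (u + 1)) = x + (u + 1) by simp only [hop]; split_ifs <;> omega,
        h1] at h2
      simp only [cyc] at h2 ⊢; split_ifs at h2 ⊢ <;> omega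
  have hrrun : ∀ x ≤ n, run (rights T) x = cyc n x := by
    intro x hx
    have h1 := run_map_placeR_outside (u := u) hm hl x
    rw [← hT] at h1
    by_cases hxu : x = u
    · have h2 := hrun (u + m) (by omega)
      rw [show hop (u, u + m) (u + m) = gapR u m x by
        simp only [hop, gapR]; split_ifs <;> omega, h1] at h2
      simp only [cyc, gapR] at h2 ⊢; split_ifs at h2 ⊢ <;> omega
    · have h2 := hrun (gapR u m x) (by unfold gapR; split_ifs <;> omega)
      rw [show hop (u, u + m) (gapR u m x) = gapR u m x by
        simp only [hop, gapR]; split_ifs <;> omega, h1] at h2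
      simp only [cyc, gapR] at h2 ⊢; split_ifs at h2 ⊢ <;> omega
  -- The lengths of the factors sum to `k + n` and are at least `k` and `n`, so both bounds are
  -- equalities.
  have hlen := h.length_eq
  have hsum := length_lefts_add_length_rights T
  have h1 := le_length_of_run_eq hlrun
  have h2 := le_length_of_run_eq hrrun
  have h3 : L.length = T.length := by rw [hT, List.length_map]
  simp only [List.length_cons] at hlen
  exact ⟨n, k, m, T, hm.symm, rfl, rfl, hu, hT, ⟨by omega, hl, hlrun⟩, ⟨by omega, hr, hrrun⟩⟩

/-! ### The trajectory of the largest point -/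

theorem le_and_eq_or_of_gapR (u m x : ℕ) :
    (x ≤ u ∧ gapR u m x = x) ∨ (u < x ∧ gapR u m x = x + m) := by
  unfold gapR; split_ifs <;> omega

/-- All arcs placed in the gap start to the right of `u`, so they are counted together exactly when
`x ≤ u`. -/
theorem countP_map_placeR {u m k x : ℕ} (hm : k + 1 = m) {T : List ((ℕ × ℕ) ⊕ (ℕ × ℕ))}
    (hT : ∀ e ∈ lefts T, e.1 < e.2 ∧ e.2 ≤ k) :
    (T.map (placeR u m)).countP (fun e => gapR u m x ≤ e.1) =
      (if x ≤ u then (lefts T).length else 0) + (rights T).countP (fun e => x ≤ e.1) ∧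
    (T.map (placeR u m)).countP (fun e => gapR u m x < e.1) =
      (if x ≤ u then (lefts T).length else 0) + (rights T).countP (fun e => x < e.1) := by
  have hx := le_and_eq_or_of_gapR u m x
  generalize gapR u m x = y at *
  induction T with
  | nil => simp
  | cons e T ih =>
    cases e with
    | inl e =>
      have he := hT e (by simp)
      have := ih (fun e' h => hT e' (by simp at h ⊢; exact Or.inr h))
      rw [List.map_cons, List.countP_cons, List.countP_cons, this.1, this.2]
      have hp : (placeR u m (.inl e)).1 = e.1 + (u + 1) := rfl
      simp only [lefts_inl, rights_inl, List.length_cons, decide_eq_true_eq]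
      constructor <;> split_ifs <;> omega
    | inr e =>
      have := ih hT
      have he := le_and_eq_or_of_gapR u m e.1
      rw [List.map_cons, List.countP_cons, List.countP_cons, this.1, this.2]
      have hp : (placeR u m (.inr e)).1 = gapR u m e.1 := rfl
      simp only [lefts_inr, rights_inr, List.countP_cons, decide_eq_true_eq]
      constructor <;> split_ifs <;> omega

/-- If the largest point is at `x` after the arcs of `A`, then no arc of `A` passes over the
gap to the left of `x`, no arc of `B` passes over the gap to the right of `x`, and the number of
arcs to the right of `x` is `n - x`. -/
theorem trajectory {n : ℕ} {A B : List (ℕ × ℕ)} (h : Fact n (A ++ B)) :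
    (∀ e ∈ A, ¬ (e.1 < run A n ∧ run A n ≤ e.2)) ∧ (∀ e ∈ B, ¬ (e.1 ≤ run A n ∧ run A n < e.2)) ∧
      A.countP (fun e => run A n ≤ e.1) + B.countP (fun e => run A n < e.1) + run A n = n := by
  -- Splitting off the first arc of `A` leaves the trajectory in the large factor. The induction is
  -- strong because arcs of the small factor are dropped from `A` as well.
  induction hlen : A.length using Nat.strong_induction_on generalizing n A B with
  | _ l ih =>
  subst hlen
  match A with
  | [] =>
    refine ⟨by simp, fun e he => ?_, ?_⟩
    · have := h.valid e he
      simp only [run_nil]; omega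
    · rw [List.countP_nil, zero_add, run_nil, Nat.add_eq_right, List.countP_eq_zero]
      intro e he
      have := h.valid e he
      rw [decide_eq_true_eq]
      omega
  | (a, b) :: A =>
    obtain ⟨n, k, m, T, hm, rfl, rfl, ha, hT, hl, hr⟩ := exists_placeR_of_fact_cons h
    obtain ⟨T₁, T₂, rfl, rfl, rfl⟩ := List.append_eq_map_iff.1 hT
    rw [rights_append] at hr
    obtain ⟨ih1, ih2, ih3⟩ := ih _ (by
      have := length_lefts_add_length_rights T₁
      simp; omega) hr rfl
    -- After the first arc the largest point is at the image of the largest point of the large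
    -- factor. It has moved only if `a = n`.
    have hstart : hop (a, a + m) (n + m) = gapR a m n := by
      simp only [hop, gapR]; split_ifs <;> omega
    have hlv := hl.valid
    simp only [lefts_append, List.mem_append] at hlv
    have hend : run ((a, a + m) :: T₁.map (placeR a m)) (n + m) =
        gapR a m (run (rights T₁) n) := by
      rw [run_cons, hstart, run_map_placeR_outside hm fun e he => hlv e (Or.inl he)]
    rw [hend]
    generalize run (rights T₁) n = x at *
    refine ⟨?_, ?_, ?_⟩
    · intro e he
      rcases List.mem_cons.1 he with rfl | he
      · simp only [gapR]; split_ifs <;> omega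
      · obtain ⟨e, hmem, rfl⟩ := List.mem_map.1 he
        cases e with
        | inl e =>
          have := hlv e (Or.inl (mem_lefts.2 hmem))
          simp only [gapR, placeR]; split_ifs <;> omega
        | inr e =>
          have := ih1 e (mem_rights.2 hmem)
          simp only [gapR, placeR]; split_ifs <;> omega
    · intro e he
      obtain ⟨e, hmem, rfl⟩ := List.mem_map.1 he
      cases e with
      | inl e =>
        have := hlv e (Or.inr (mem_lefts.2 hmem))
        simp only [gapR, placeR]; split_ifs <;> omega
      | inr e =>
        have := ih2 e (mem_rights.2 hmem)
        simp only [gapR, placeR]; split_ifs <;> omega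
    · have h1 := (countP_map_placeR (u := a) (x := x) hm fun e he => hlv e (Or.inl he)).1
      have h2 := (countP_map_placeR (u := a) (x := x) hm fun e he => hlv e (Or.inr he)).2
      have h3 := hl.length_eq
      simp only [lefts_append, List.length_append] at h3
      rw [List.countP_cons, h1, h2]
      have hx := le_and_eq_or_of_gapR a m x
      generalize gapR a m x = y at *
      simp only [decide_eq_true_eq]
      split_ifs <;> omega

/-! ### Marking a jump of the trajectory -/

/-- Combines a factorization `lefts T₂ ++ lefts T₁` of the small cycle and a factorization
`rights T₁ ++ rights T₂` of the large cycle by inserting the new arc `(u, u + m)`. -/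
def assemble (u m : ℕ) (T₁ T₂ : List ((ℕ × ℕ) ⊕ (ℕ × ℕ))) : List (ℕ × ℕ) :=
  T₁.map (placeL u m) ++ (u, u + m) :: T₂.map (placeR u m)

/-- Conjugation by the big cycle shifts the small block `[u, u + m)` to `(u, u + m]` without
rotating it inside, and acts on the complement as conjugation by the large factor's own cycle. This
is why arcs before the marked one use `placeL` and arcs after it use `placeR`. -/
theorem rotUp_placeL {n m k u : ℕ} (hm : k + 1 = m) (hu : u ≤ n) {e : (ℕ × ℕ) ⊕ (ℕ × ℕ)}
    (hl : ∀ e', e = .inl e' → e'.1 < e'.2 ∧ e'.2 ≤ k)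
    (hr : ∀ e', e = .inr e' → e'.1 < e'.2 ∧ e'.2 ≤ n) :
    rotUp (n + m) (placeL u m e) = placeR u m (e.map id (rotUp n)) := by
  cases e with
  | inl e =>
    have := hl e rfl
    rw [rotUp, if_pos (by simp only [placeL]; omega)]
    simp only [placeL, placeR, Sum.map_inl, id, Prod.mk.injEq]
    omega
  | inr e =>
    have := hr e rfl
    obtain ⟨a, b⟩ := e
    simp only at this
    rw [Sum.map_inr]
    by_cases hb : b < n
    · rw [rotUp, if_pos (by simp only [placeL, gapL]; split_ifs <;> omega), rotUp, if_pos hb]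
      simp only [placeL, placeR, gapL, gapR, Prod.mk.injEq]
      constructor <;> split_ifs <;> omega
    · rw [rotUp, if_neg (by simp only [placeL, gapL]; split_ifs <;> omega), rotUp, if_neg hb]
      simp only [placeL, placeR, gapL, gapR, Prod.mk.injEq]
      constructor <;> split_ifs <;> omega

theorem map_rotUp_map_placeL {n m k u : ℕ} (hm : k + 1 = m) (hu : u ≤ n)
    {T : List ((ℕ × ℕ) ⊕ (ℕ × ℕ))} (hl : ∀ e ∈ lefts T, e.1 < e.2 ∧ e.2 ≤ k)
    (hr : ∀ e ∈ rights T, e.1 < e.2 ∧ e.2 ≤ n) :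
    (T.map (placeL u m)).map (rotUp (n + m)) =
      (T.map (Sum.map id (rotUp n))).map (placeR u m) := by
  rw [List.map_map, List.map_map]
  refine List.map_congr_left fun e he => rotUp_placeL hm hu ?_ ?_
  · rintro e' rfl; exact hl e' (mem_lefts.2 he)
  · rintro e' rfl; exact hr e' (mem_rights.2 he)

theorem placeL_valid {n m k u : ℕ} (hm : k + 1 = m) (hu : u ≤ n)
    {T : List ((ℕ × ℕ) ⊕ (ℕ × ℕ))} (hl : ∀ e ∈ lefts T, e.1 < e.2 ∧ e.2 ≤ k)
    (hr : ∀ e ∈ rights T, e.1 < e.2 ∧ e.2 ≤ n) :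
    ∀ e ∈ T.map (placeL u m), e.1 < e.2 ∧ e.2 ≤ n + m := by
  intro e he
  obtain ⟨e, hmem, rfl⟩ := List.mem_map.1 he
  cases e with
  | inl e =>
    have := hl e (mem_lefts.2 hmem)
    simp only [placeL]; omega
  | inr e =>
    have := hr e (mem_rights.2 hmem)
    simp only [placeL, gapL]; split_ifs <;> omega

/-- Rotating the arcs before the marked one to the end reduces this to the case where the marked arc
comes first. -/
theorem Fact.assemble {n m k u : ℕ} (hm : k + 1 = m) (hu : u ≤ n)
    {T₁ T₂ : List ((ℕ × ℕ) ⊕ (ℕ × ℕ))} (hl : Fact k (lefts T₂ ++ lefts T₁))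
    (hr : Fact n (rights T₁ ++ rights T₂)) : Fact (n + m) (assemble u m T₁ T₂) := by
  have hl₁ : ∀ e ∈ lefts T₁, e.1 < e.2 ∧ e.2 ≤ k :=
    fun e he => hl.valid e (List.mem_append_right _ he)
  have hr₁ : ∀ e ∈ rights T₁, e.1 < e.2 ∧ e.2 ≤ n :=
    fun e he => hr.valid e (List.mem_append_left _ he)
  rw [MinFact.assemble, fact_rotate_iff (placeL_valid hm hu hl₁ hr₁),
    map_rotUp_map_placeL hm hu hl₁ hr₁, List.cons_append, ← List.map_append]
  refine Fact.cons_placeR hm hu ?_ ?_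
  · simpa [lefts_map_sumMap] using hl
  · rw [rights_append, rights_map_sumMap]
    exact (fact_rotate_iff hr₁).1 hr

theorem exists_assemble {N a b : ℕ} {L₁ L₂ : List (ℕ × ℕ)} (h : Fact N (L₁ ++ (a, b) :: L₂)) :
    ∃ n k m T₁ T₂, k + 1 = m ∧ b = a + m ∧ N = n + m ∧ a ≤ n ∧ L₁ = T₁.map (placeL a m) ∧
      L₂ = T₂.map (placeR a m) ∧ Fact k (lefts T₂ ++ lefts T₁) ∧
      Fact n (rights T₁ ++ rights T₂) := by
  have hL₁ : ∀ e ∈ L₁, e.1 < e.2 ∧ e.2 ≤ N := fun e he => h.valid e (List.mem_append_left _ he)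
  have h' := (fact_rotate_iff hL₁).1 h
  rw [List.cons_append] at h'
  obtain ⟨n, k, m, T, hm, rfl, rfl, ha, hT, hl, hr⟩ := exists_placeR_of_fact_cons h'
  obtain ⟨T₂, T', rfl, hT₂, hT'⟩ := List.append_eq_map_iff.1 hT
  rw [lefts_append] at hl
  rw [rights_append] at hr
  have hrv : ∀ e ∈ rights T', e.1 < e.2 ∧ e.2 ≤ n :=
    fun e he => hr.valid e (List.mem_append_right _ he)
  have hlv : ∀ e ∈ lefts T', e.1 < e.2 ∧ e.2 ≤ k :=
    fun e he => hl.valid e (List.mem_append_right _ he)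
  -- Only the large factor's arcs need rotating back; for the small ones, the offset between
  -- `placeL` and `placeR` absorbs the rotation.
  set T₁ := T'.map (Sum.map id (rotDown n)) with hT₁
  have hl₁ : lefts T₁ = lefts T' := by rw [hT₁, lefts_map_sumMap, List.map_id]
  have hr₁ : rights T₁ = (rights T').map (rotDown n) := by rw [hT₁, rights_map_sumMap]
  have hrv₁ : ∀ e ∈ rights T₁, e.1 < e.2 ∧ e.2 ≤ n := by
    intro e he
    rw [hr₁] at he
    obtain ⟨e, hmem, rfl⟩ := List.mem_map.1 he
    exact rotDown_valid (hrv e hmem)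
  have hback : (rights T₁).map (rotUp n) = rights T' := by
    rw [hr₁, List.map_map]
    conv_rhs => rw [← List.map_id (rights T')]
    exact List.map_congr_left fun e he => rotUp_rotDown (hrv e he)
  have hT₁' : T₁.map (Sum.map id (rotUp n)) = T' := by
    rw [hT₁, List.map_map]
    conv_rhs => rw [← List.map_id T']
    refine List.map_congr_left fun e he => ?_
    cases e with
    | inl e => rfl
    | inr e => simp [rotUp_rotDown (hrv e (mem_rights.2 he))]
  refine ⟨n, k, m, T₁, T₂, hm, rfl, rfl, ha, ?_, hT₂.symm, by rwa [hl₁], ?_⟩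
  · have h1 := map_rotUp_map_placeL hm ha (hl₁ ▸ hlv) hrv₁
    rw [hT₁', hT'] at h1
    have h2 : ∀ L : List (ℕ × ℕ), (∀ e ∈ L, e.1 < e.2 ∧ e.2 ≤ n + m) →
        (L.map (rotUp (n + m))).map (rotDown (n + m)) = L := fun L hL => by
      rw [List.map_map]
      conv_rhs => rw [← List.map_id L]
      exact List.map_congr_left fun e he => rotDown_rotUp (hL e he)
    rw [← h2 L₁ hL₁, ← h1, h2 _ (placeL_valid hm ha (hl₁ ▸ hlv) hrv₁)]
  · rw [fact_rotate_iff hrv₁, hback]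
    exact hr

/-! ### Areas -/

/-- The sum of the lower ends of the arcs. -/
def sumLower (L : List (ℕ × ℕ)) : ℕ := (L.map Prod.fst).sum

/-- The sum of the upper ends of the arcs. -/
def sumUpper (L : List (ℕ × ℕ)) : ℕ := (L.map Prod.snd).sum

@[simp] theorem sumLower_append (A B : List (ℕ × ℕ)) :
    sumLower (A ++ B) = sumLower A + sumLower B := by simp [sumLower]

@[simp] theorem sumUpper_append (A B : List (ℕ × ℕ)) :
    sumUpper (A ++ B) = sumUpper A + sumUpper B := by simp [sumUpper]

@[simp] theorem sumLower_cons (e : ℕ × ℕ) (B : List (ℕ × ℕ)) :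
    sumLower (e :: B) = e.1 + sumLower B := by simp [sumLower]

@[simp] theorem sumUpper_cons (e : ℕ × ℕ) (B : List (ℕ × ℕ)) :
    sumUpper (e :: B) = e.2 + sumUpper B := by simp [sumUpper]

theorem sum_map_placeL (u m : ℕ) (T : List ((ℕ × ℕ) ⊕ (ℕ × ℕ))) :
    sumLower (T.map (placeL u m)) = sumLower (lefts T) + u * (lefts T).length +
      sumLower (rights T) + m * (rights T).countP (fun e => u ≤ e.1) ∧
    sumUpper (T.map (placeL u m)) = sumUpper (lefts T) + u * (lefts T).length +
      sumUpper (rights T) + m * (rights T).countP (fun e => u ≤ e.2) := by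
  induction T with
  | nil => simp [sumLower, sumUpper]
  | cons e T ih =>
    cases e with
    | inl e => simp [ih, placeL]; constructor <;> ring
    | inr e =>
      simp only [List.map_cons, sumLower_cons, sumUpper_cons, ih, lefts_inr, rights_inr,
        List.countP_cons, placeL, gapL, decide_eq_true_eq]
      constructor
      · by_cases h : e.1 < u
        · rw [if_pos h, if_neg (by omega)]; ring
        · rw [if_neg h, if_pos (by omega)]; ring
      · by_cases h : e.2 < u
        · rw [if_pos h, if_neg (by omega)]; ring
        · rw [if_neg h, if_pos (by omega)]; ring

theorem sum_map_placeR (u m : ℕ) (T : List ((ℕ × ℕ) ⊕ (ℕ × ℕ))) :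
    sumLower (T.map (placeR u m)) = sumLower (lefts T) + (u + 1) * (lefts T).length +
      sumLower (rights T) + m * (rights T).countP (fun e => u < e.1) ∧
    sumUpper (T.map (placeR u m)) = sumUpper (lefts T) + (u + 1) * (lefts T).length +
      sumUpper (rights T) + m * (rights T).countP (fun e => u < e.2) := by
  induction T with
  | nil => simp [sumLower, sumUpper]
  | cons e T ih =>
    cases e with
    | inl e => simp [ih, placeR]; constructor <;> ring
    | inr e =>
      simp only [List.map_cons, sumLower_cons, sumUpper_cons, ih, lefts_inr, rights_inr,
        List.countP_cons, placeR, gapR, decide_eq_true_eq]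
      constructor
      · by_cases h : e.1 ≤ u
        · rw [if_pos h, if_neg (by omega)]; ring
        · rw [if_neg h, if_pos (by omega)]; ring
      · by_cases h : e.2 ≤ u
        · rw [if_pos h, if_neg (by omega)]; ring
        · rw [if_neg h, if_pos (by omega)]; ring

/-- The lower area of a list of arcs. -/
def listAreaL (n : ℕ) (L : List (ℕ × ℕ)) : ℤ := (n.choose 2 : ℤ) - sumLower L

/-- The upper area of a list of arcs. -/
def listAreaU (n : ℕ) (L : List (ℕ × ℕ)) : ℤ := sumUpper L - (n.choose 2 : ℤ)

theorem choose_two_add (n k : ℕ) :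
    (n + (k + 1)).choose 2 = n.choose 2 + k.choose 2 + n * (k + 1) + k := by
  induction n with
  | zero => rw [zero_add, Nat.choose_succ_succ' k 1]; simp; ring
  | succ n ih =>
    rw [show n + 1 + (k + 1) = (n + (k + 1)) + 1 by ring, Nat.choose_succ_succ' _ 1, ih,
      Nat.choose_succ_succ' n 1]
    simp; ring

/-- By `trajectory`, opening the gap at the current point `u` shifts the lower ends of exactly `n -
u` large arcs by `m`. The small arcs move by `u` before the jump and by `u + 1` after it. With the
new arc the dependence on `u` cancels, and only the numbers of small arcs before and after remain.
-/
theorem area_assemble {n m k : ℕ} (hm : k + 1 = m) {T₁ T₂ : List ((ℕ × ℕ) ⊕ (ℕ × ℕ))}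
    (hl : Fact k (lefts T₂ ++ lefts T₁)) (hr : Fact n (rights T₁ ++ rights T₂)) :
    listAreaL (n + m) (assemble (run (rights T₁) n) m T₁ T₂) =
      listAreaL k (lefts T₂ ++ lefts T₁) + listAreaL n (rights T₁ ++ rights T₂) +
        (lefts T₁).length ∧
    listAreaU (n + m) (assemble (run (rights T₁) n) m T₁ T₂) =
      listAreaU k (lefts T₂ ++ lefts T₁) + listAreaU n (rights T₁ ++ rights T₂) +
        ((lefts T₂).length + 1 : ℕ) := by
  obtain ⟨h1, h2, h3⟩ := trajectory hr
  generalize run (rights T₁) n = u at *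
  -- No large arc passes over the place where the gap opens, so an upper end shifts exactly when its
  -- lower end does.
  have c1 : (rights T₁).countP (fun e => u ≤ e.2) = (rights T₁).countP (fun e => u ≤ e.1) := by
    refine List.countP_congr fun e he => ?_
    have := h1 e he
    have := hr.valid e (by simp [he])
    simp only [decide_eq_true_eq]; omega
  have c2 : (rights T₂).countP (fun e => u < e.2) = (rights T₂).countP (fun e => u < e.1) := by
    refine List.countP_congr fun e he => ?_
    have := h2 e he
    have := hr.valid e (by simp [he])
    simp only [decide_eq_true_eq]; omega
  have hlen := hl.length_eq
  rw [List.length_append] at hlen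
  obtain ⟨l1, l2⟩ := sum_map_placeL u m T₁
  obtain ⟨r1, r2⟩ := sum_map_placeR u m T₂
  subst hm
  have hch := choose_two_add n k
  simp only [listAreaL, listAreaU, assemble, sumLower_append, sumUpper_append, sumLower_cons,
    sumUpper_cons, l1, l2, r1, r2, c1, c2, hch]
  generalize (rights T₁).countP (fun e => u ≤ e.1) = x at *
  generalize (rights T₂).countP (fun e => u < e.1) = y at *
  subst h3 hlen
  constructor <;> push_cast <;> ring

/-! ### Factorizations as lists of arcs -/

/-- The arc of a transposition. -/
noncomputable def arc {n : ℕ} (π : Equiv.Perm (Fin (n + 1))) : ℕ × ℕ :=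
  ((lower π : ℕ), (upper π : ℕ))

/-- The list of arcs of a sequence of transpositions. -/
noncomputable def arcs {n m : ℕ} (τ : Fin m → Equiv.Perm (Fin (n + 1))) : List (ℕ × ℕ) :=
  (List.ofFn τ).map arc

theorem exists_lt_of_isSwap {n : ℕ} {π : Equiv.Perm (Fin (n + 1))} (h : π.IsSwap) :
    ∃ a b, a < b ∧ π = Equiv.swap a b := by
  obtain ⟨a, b, hab, rfl⟩ := h
  rcases lt_or_gt_of_ne hab with h | h
  · exact ⟨a, b, h, rfl⟩
  · exact ⟨b, a, h, Equiv.swap_comm a b⟩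

theorem arc_swap {n : ℕ} {a b : Fin (n + 1)} (h : a < b) :
    arc (Equiv.swap a b) = ((a : ℕ), (b : ℕ)) := by
  rw [arc, lower_swap h, upper_swap h]

theorem arc_valid {n : ℕ} {π : Equiv.Perm (Fin (n + 1))} (h : π.IsSwap) :
    (arc π).1 < (arc π).2 ∧ (arc π).2 ≤ n := by
  obtain ⟨a, b, hab, rfl⟩ := exists_lt_of_isSwap h
  rw [arc_swap hab]
  exact ⟨hab, by simp only; omega⟩

theorem arc_injOn {n : ℕ} {π σ : Equiv.Perm (Fin (n + 1))} (hπ : π.IsSwap) (hσ : σ.IsSwap)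
    (h : arc π = arc σ) : π = σ := by
  obtain ⟨a, b, hab, rfl⟩ := exists_lt_of_isSwap hπ
  obtain ⟨c, d, hcd, rfl⟩ := exists_lt_of_isSwap hσ
  rw [arc_swap hab, arc_swap hcd, Prod.mk.injEq] at h
  rw [Fin.ext h.1, Fin.ext h.2]

theorem hop_arc {n : ℕ} {π : Equiv.Perm (Fin (n + 1))} (h : π.IsSwap) (x : Fin (n + 1)) :
    hop (arc π) x = (π x : Fin (n + 1)) := by
  obtain ⟨a, b, hab, rfl⟩ := exists_lt_of_isSwap h
  rw [arc_swap hab, hop, Equiv.swap_apply_def]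
  simp only [Fin.ext_iff]
  split_ifs <;> rfl

theorem run_map_arc {n : ℕ} (l : List (Equiv.Perm (Fin (n + 1)))) (hl : ∀ π ∈ l, π.IsSwap)
    (x : Fin (n + 1)) : run (l.map arc) x = (l.reverse.prod x : Fin (n + 1)) := by
  induction l generalizing x with
  | nil => rfl
  | cons π l ih =>
    rw [List.map_cons, run_cons, hop_arc (hl π (by simp)),
      ih fun σ h => hl σ (List.mem_cons_of_mem _ h)]
    simp

theorem canonicalCycle_apply (n : ℕ) (x : Fin (n + 1)) :
    (canonicalCycle n x : ℕ) = cyc n x := by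
  unfold canonicalCycle cyc
  split_ifs with h
  · rw [finRotate_of_lt h]
  · have : x = Fin.last n := Fin.ext (by simp only [Fin.val_last]; omega)
    rw [this, finRotate_last]; rfl

theorem fact_arcs_iff {n : ℕ} {τ : Fin n → Equiv.Perm (Fin (n + 1))} (hτ : ∀ i, (τ i).IsSwap) :
    Fact n (arcs τ) ↔ leftToRightProd τ = canonicalCycle n := by
  have hl : ∀ π ∈ List.ofFn τ, π.IsSwap := fun π h => by
    obtain ⟨i, rfl⟩ := (List.mem_ofFn' _ _).1 h
    exact hτ i
  constructor
  · intro h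
    ext x
    rw [canonicalCycle_apply, ← h.run_eq x (by omega), arcs, run_map_arc _ hl, leftToRightProd]
  · intro h
    refine ⟨by simp [arcs], fun e he => ?_, fun x hx => ?_⟩
    · obtain ⟨π, hπ, rfl⟩ := List.mem_map.1 he
      exact arc_valid (hl π hπ)
    · have h1 := run_map_arc _ hl ⟨x, by omega⟩
      rw [← leftToRightProd, h, canonicalCycle_apply] at h1
      exact h1

theorem mem_minimalFactorizations {n : ℕ} {τ : Fin n → Equiv.Perm (Fin (n + 1))} :
    τ ∈ minimalFactorizations n ↔ (∀ i, (τ i).IsSwap) ∧ Fact n (arcs τ) := by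
  simp only [minimalFactorizations, Finset.mem_filter, Finset.mem_univ, true_and]
  exact and_congr_right fun h => (fact_arcs_iff h).symm

theorem exists_arcs_eq {n : ℕ} {L : List (ℕ × ℕ)} (h : Fact n L) :
    ∃ τ ∈ minimalFactorizations n, arcs τ = L := by
  have hv : ∀ i : Fin n, ∃ π : Equiv.Perm (Fin (n + 1)), π.IsSwap ∧
      arc π = L[(i : ℕ)]'(by rw [h.length_eq]; exact i.2) := fun i => by
    have := h.valid (L[(i : ℕ)]'(by rw [h.length_eq]; exact i.2)) (List.getElem_mem _)
    generalize L[(i : ℕ)]'(by rw [h.length_eq]; exact i.2) = e at *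
    have hlt : (⟨e.1, by omega⟩ : Fin (n + 1)) < ⟨e.2, by omega⟩ := this.1
    exact ⟨Equiv.swap ⟨e.1, by omega⟩ ⟨e.2, by omega⟩, ⟨_, _, hlt.ne, rfl⟩, by rw [arc_swap hlt]⟩
  choose τ hτ harc using hv
  have : arcs τ = L := by
    refine List.ext_getElem (by simp [arcs, h.length_eq]) fun i h1 h2 => ?_
    simp [arcs, harc]
  exact ⟨τ, mem_minimalFactorizations.2 ⟨hτ, this ▸ h⟩, this⟩

/-- The minimal factorizations of `(0 1 ⋯ n)` as lists of arcs. -/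
noncomputable def factFinset (n : ℕ) : Finset (List (ℕ × ℕ)) := (minimalFactorizations n).image arcs

@[simp] theorem mem_factFinset {n : ℕ} {L : List (ℕ × ℕ)} : L ∈ factFinset n ↔ Fact n L := by
  rw [factFinset, Finset.mem_image]
  constructor
  · rintro ⟨τ, hτ, rfl⟩
    exact (mem_minimalFactorizations.1 hτ).2
  · exact fun h => exists_arcs_eq h

theorem arcs_injOn (n : ℕ) :
    Set.InjOn (arcs : (Fin n → Equiv.Perm (Fin (n + 1))) → _) (minimalFactorizations n) := by
  intro τ hτ σ hσ h
  have h1 := (mem_minimalFactorizations.1 hτ).1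
  have h2 := (mem_minimalFactorizations.1 hσ).1
  rw [arcs, arcs, List.map_ofFn, List.map_ofFn] at h
  have h3 := List.ofFn_injective h
  funext i
  exact arc_injOn (h1 i) (h2 i) (congrFun h3 i)

theorem areaL_eq {n : ℕ} (τ : Fin n → Equiv.Perm (Fin (n + 1))) :
    areaL τ = listAreaL n (arcs τ) := by
  simp [areaL, listAreaL, arcs, sumLower, arc, List.map_ofFn, List.sum_ofFn]

theorem areaU_eq {n : ℕ} (τ : Fin n → Equiv.Perm (Fin (n + 1))) :
    areaU τ = listAreaU n (arcs τ) := by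
  simp [areaU, listAreaU, arcs, sumUpper, arc, List.map_ofFn, List.sum_ofFn]

/-- The monomial of a list of arcs. -/
noncomputable def weight (n : ℕ) (L : List (ℕ × ℕ)) : Coeff :=
  q ^ (listAreaL n L).toNat * t ^ (listAreaU n L).toNat

theorem F_eq_sum (n : ℕ) : F n = ∑ L ∈ factFinset n, weight n L := by
  rw [factFinset, Finset.sum_image (arcs_injOn n), F]
  exact Finset.sum_congr rfl fun τ _ => by rw [weight, areaL_eq, areaU_eq]

/-! ### Jumps -/

theorem gapL_of_le {u n m : ℕ} (h : u ≤ n) : gapL u m n = n + m := by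
  unfold gapL; split_ifs <;> omega

/-- The marked arc is a jump of the largest point precisely when the gap was opened at the large
factor's current point. -/
theorem run_map_placeL_eq_iff {n m k a : ℕ} (hm : k + 1 = m) (ha : a ≤ n)
    {T : List ((ℕ × ℕ) ⊕ (ℕ × ℕ))} (hl : ∀ e ∈ lefts T, e.1 < e.2 ∧ e.2 ≤ k) :
    run (T.map (placeL a m)) (n + m) = a + m ↔ run (rights T) n = a := by
  rw [← gapL_of_le ha, run_map_placeL_outside hm hl]
  unfold gapL; split_ifs <;> omega

/-- Jumps go down: an arc starting at the current point would pass over the gap to its right, which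
`trajectory` forbids. -/
theorem eq_snd_of_hop_ne {N : ℕ} {e : ℕ × ℕ} {L₁ L₂ : List (ℕ × ℕ)} (h : Fact N (L₁ ++ e :: L₂))
    (hne : hop e (run L₁ N) ≠ run L₁ N) : run L₁ N = e.2 := by
  have h1 := (trajectory h).2.1 e (by simp)
  have h2 := h.valid e (by simp)
  unfold hop at hne
  split_ifs at hne <;> omega

/-- A factorization in which the arc after `L₁` moves the current point of the trajectory comes
from two smaller ones. -/
theorem exists_assemble_of_hop_ne {N : ℕ} {e : ℕ × ℕ} {L₁ L₂ : List (ℕ × ℕ)}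
    (h : Fact N (L₁ ++ e :: L₂)) (hne : hop e (run L₁ N) ≠ run L₁ N) :
    ∃ n k m T₁ T₂, k + 1 = m ∧ N = n + m ∧ T₁.length = L₁.length ∧ T₂.length = L₂.length ∧
      L₁ ++ e :: L₂ = assemble (run (rights T₁) n) m T₁ T₂ ∧ Fact k (lefts T₂ ++ lefts T₁) ∧
      Fact n (rights T₁ ++ rights T₂) := by
  have hj := eq_snd_of_hop_ne h hne
  obtain ⟨a, b⟩ := e
  obtain ⟨n, k, m, T₁, T₂, hm, rfl, rfl, ha, rfl, rfl, hl, hr⟩ := exists_assemble h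
  have := (run_map_placeL_eq_iff hm ha fun e he => hl.valid e (by simp [he])).1 hj
  exact ⟨n, k, m, T₁, T₂, hm, rfl, by simp, by simp, by rw [this]; rfl, hl, hr⟩

theorem exists_hop_ne {L : List (ℕ × ℕ)} {x : ℕ} (h : run L x ≠ x) :
    ∃ L₁ e L₂, L = L₁ ++ e :: L₂ ∧ hop e (run L₁ x) ≠ run L₁ x := by
  induction L generalizing x with
  | nil => exact absurd rfl h
  | cons e L ih =>
    by_cases he : hop e x = x
    · rw [run_cons, he] at h
      obtain ⟨L₁, e', L₂, rfl, h'⟩ := ih h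
      exact ⟨e :: L₁, e', L₂, rfl, by rwa [run_cons, he]⟩
    · exact ⟨[], e, L, rfl, he⟩

theorem Fact.area_nonneg {n : ℕ} {L : List (ℕ × ℕ)} (h : Fact n L) :
    0 ≤ listAreaL n L ∧ 0 ≤ listAreaU n L := by
  induction n using Nat.strong_induction_on generalizing L with
  | _ N ih =>
  by_cases hN : N = 0
  · subst hN
    have := List.length_eq_zero_iff.1 h.length_eq
    subst this
    simp [listAreaL, listAreaU, sumLower, sumUpper]
  -- For `N > 0` the largest point must reach `0`, so some jump exists and the factorization splits.
  · have hne : run L N ≠ N := by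
      rw [h.run_eq N le_rfl]; simp [cyc]; omega
    obtain ⟨L₁, e, L₂, rfl, hj⟩ := exists_hop_ne hne
    obtain ⟨n, k, m, T₁, T₂, hm, rfl, -, -, heq, hl, hr⟩ := exists_assemble_of_hop_ne h hj
    rw [heq, (area_assemble hm hl hr).1, (area_assemble hm hl hr).2]
    have h1 := ih k (by omega) hl
    have h2 := ih n (by omega) hr
    omega

theorem weight_assemble {n m k : ℕ} (hm : k + 1 = m) {T₁ T₂ : List ((ℕ × ℕ) ⊕ (ℕ × ℕ))}
    (hl : Fact k (lefts T₂ ++ lefts T₁)) (hr : Fact n (rights T₁ ++ rights T₂)) :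
    weight (n + m) (assemble (run (rights T₁) n) m T₁ T₂) =
      q ^ (lefts T₁).length * t ^ ((lefts T₂).length + 1) *
        (weight k (lefts T₂ ++ lefts T₁) * weight n (rights T₁ ++ rights T₂)) := by
  obtain ⟨h1, h2⟩ := hl.area_nonneg
  obtain ⟨h3, h4⟩ := hr.area_nonneg
  simp only [weight]
  rw [(area_assemble hm hl hr).1, (area_assemble hm hl hr).2,
    Int.toNat_add (by omega) (by omega), Int.toNat_add h1 h3,
    Int.toNat_add (by omega) (by omega), Int.toNat_add h2 h4]
  simp only [Int.toNat_natCast, pow_add]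
  ring

/-! ### Shuffles -/

/-- The lists of booleans of length `n`. -/
def bools : ℕ → Finset (List Bool)
  | 0 => {[]}
  | n + 1 => (bools n).image (true :: ·) ∪ (bools n).image (false :: ·)

@[simp] theorem mem_bools {n : ℕ} {s : List Bool} : s ∈ bools n ↔ s.length = n := by
  induction n generalizing s with
  | zero => simp [bools]
  | succ n ih =>
    cases s with
    | nil => simp [bools]
    | cons b s => cases b <;> simp [bools, ih]

theorem sum_bools_succ {M : Type*} [AddCommMonoid M] (n : ℕ) (f : List Bool → M) :
    ∑ s ∈ bools (n + 1), f s = ∑ s ∈ bools n, f (true :: s) + ∑ s ∈ bools n, f (false :: s) := by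
  rw [bools, Finset.sum_union, Finset.sum_image (by simp), Finset.sum_image (by simp)]
  rw [Finset.disjoint_left]
  intro s h1 h2
  simp only [Finset.mem_image] at h1 h2
  obtain ⟨a, -, rfl⟩ := h1
  obtain ⟨b, -, h⟩ := h2
  simp at h

section
variable {α β : Type*}

/-- The shuffle of two lists prescribed by a list of booleans. -/
def shuffle : List Bool → List α → List β → List (α ⊕ β)
  | true :: s, a :: A, B => .inl a :: shuffle s A B
  | false :: s, A, b :: B => .inr b :: shuffle s A B
  -- Reached with data left over only when the word does not match the two lengths, which
  -- `shuffle_spec` excludes.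
  | _, _, _ => []

theorem shuffle_spec (s : List Bool) (A : List α) (B : List β) (hA : s.count true = A.length)
    (hB : s.count false = B.length) :
    lefts (shuffle s A B) = A ∧ rights (shuffle s A B) = B ∧
      (shuffle s A B).map Sum.isLeft = s := by
  induction s generalizing A B with
  | nil =>
    have := List.length_eq_zero_iff.1 hA.symm
    have := List.length_eq_zero_iff.1 hB.symm
    subst A B
    simp [shuffle]
  | cons b s ih =>
    cases b with
    | true =>
      cases A with
      | nil => simp at hA
      | cons a A =>
        simp at hA hB
        obtain ⟨h1, h2, h3⟩ := ih A B hA hB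
        simp [shuffle, h1, h2, h3]
    | false =>
      cases B with
      | nil => simp at hB
      | cons b B =>
        simp at hA hB
        obtain ⟨h1, h2, h3⟩ := ih A B hA hB
        simp [shuffle, h1, h2, h3]

theorem shuffle_isLeft (T : List (α ⊕ β)) :
    shuffle (T.map Sum.isLeft) (lefts T) (rights T) = T := by
  induction T with
  | nil => simp [shuffle]
  | cons e T ih => cases e <;> simp [shuffle, ih]

theorem count_true_isLeft (T : List (α ⊕ β)) :
    (T.map Sum.isLeft).count true = (lefts T).length := by
  induction T with
  | nil => simp
  | cons e T ih => cases e <;> simp [ih]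

theorem count_false_isLeft (T : List (α ⊕ β)) :
    (T.map Sum.isLeft).count false = (rights T).length := by
  induction T with
  | nil => simp
  | cons e T ih => cases e <;> simp [ih]

end

/-! ### The contribution of the jumps at a given time -/

theorem map_eq_map_of_injOn {α β : Type*} {f : α → β} {l l' : List α}
    (hf : ∀ a ∈ l, ∀ b ∈ l', f a = f b → a = b) (h : l.map f = l'.map f) : l = l' := by
  induction l generalizing l' with
  | nil => simpa [eq_comm] using h
  | cons a l ih =>
    cases l' with
    | nil => simp at h
    | cons b l' =>
      simp only [List.map_cons, List.cons.injEq] at h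
      rw [hf a (by simp) b (by simp) h.1,
        ih (fun x hx y hy => hf x (by simp [hx]) y (by simp [hy])) h.2]

theorem placeL_injOn {u m k : ℕ} (hm : k + 1 = m) {T T' : List ((ℕ × ℕ) ⊕ (ℕ × ℕ))}
    (hT : ∀ e ∈ lefts T, e.1 < e.2 ∧ e.2 ≤ k) (hT' : ∀ e ∈ lefts T', e.1 < e.2 ∧ e.2 ≤ k)
    (h : T.map (placeL u m) = T'.map (placeL u m)) : T = T' := by
  refine map_eq_map_of_injOn (fun a ha b hb hab => ?_) h
  rcases a with ⟨a₁, a₂⟩ | ⟨a₁, a₂⟩ <;> rcases b with ⟨b₁, b₂⟩ | ⟨b₁, b₂⟩ <;>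
    simp only [placeL, gapL, Prod.mk.injEq] at hab
  · simp only [Sum.inl.injEq, Prod.mk.injEq]; omega
  · have := hT _ (mem_lefts.2 ha)
    simp only at this
    split_ifs at hab <;> omega
  · have := hT' _ (mem_lefts.2 hb)
    simp only at this
    split_ifs at hab <;> omega
  · simp only [Sum.inr.injEq, Prod.mk.injEq]
    split_ifs at hab <;> omega

theorem placeR_injOn {u m k : ℕ} (hm : k + 1 = m) {T T' : List ((ℕ × ℕ) ⊕ (ℕ × ℕ))}
    (hT : ∀ e ∈ lefts T, e.1 < e.2 ∧ e.2 ≤ k) (hT' : ∀ e ∈ lefts T', e.1 < e.2 ∧ e.2 ≤ k)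
    (h : T.map (placeR u m) = T'.map (placeR u m)) : T = T' := by
  refine map_eq_map_of_injOn (fun a ha b hb hab => ?_) h
  rcases a with ⟨a₁, a₂⟩ | ⟨a₁, a₂⟩ <;> rcases b with ⟨b₁, b₂⟩ | ⟨b₁, b₂⟩ <;>
    simp only [placeR, gapR, Prod.mk.injEq] at hab
  · simp only [Sum.inl.injEq, Prod.mk.injEq]; omega
  · have := hT _ (mem_lefts.2 ha)
    simp only at this
    split_ifs at hab <;> omega
  · have := hT' _ (mem_lefts.2 hb)
    simp only at this
    split_ifs at hab <;> omega
  · simp only [Sum.inr.injEq, Prod.mk.injEq]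
    split_ifs at hab <;> omega

/-- The data parametrizing factorizations of `(0 1 ⋯ N)` with a jump at a given time. -/
abbrev JumpData : Type :=
  (_ : List Bool × List Bool) × (List (ℕ × ℕ) × List (ℕ × ℕ))

/-- The tagged arcs before the jump. -/
def JumpData.before (d : JumpData) : List ((ℕ × ℕ) ⊕ (ℕ × ℕ)) :=
  -- The small factorization is stored rotated, with the arcs after the jump first; the large one is
  -- in order of time.
  shuffle d.1.1 (d.2.1.drop (d.1.2.count true)) (d.2.2.take (d.1.1.count false))

/-- The tagged arcs after the jump. -/
def JumpData.after (d : JumpData) : List ((ℕ × ℕ) ⊕ (ℕ × ℕ)) :=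
  shuffle d.1.2 (d.2.1.take (d.1.2.count true)) (d.2.2.drop (d.1.1.count false))

/-- The number of arcs of the small factorization. -/
def JumpData.small (d : JumpData) : ℕ := d.1.1.count true + d.1.2.count true

/-- The number of arcs of the large factorization. -/
def JumpData.large (d : JumpData) : ℕ := d.1.1.count false + d.1.2.count false

/-- The factorization with a jump determined by the data. -/
def JumpData.build (d : JumpData) : List (ℕ × ℕ) :=
  assemble (run (rights d.before) d.large) (d.small + 1) d.before d.after

/-- The data of factorizations with a jump after `p` and before `r` arcs. -/
noncomputable def jumpData (p r : ℕ) : Finset JumpData :=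
  (bools p ×ˢ bools r).sigma fun s =>
    factFinset (s.1.count true + s.2.count true) ×ˢ
      factFinset (s.1.count false + s.2.count false)

theorem mem_jumpData {p r : ℕ} {d : JumpData} : d ∈ jumpData p r ↔
    (d.1.1.length = p ∧ d.1.2.length = r) ∧ Fact d.small d.2.1 ∧ Fact d.large d.2.2 := by
  simp [jumpData, JumpData.small, JumpData.large]

theorem small_add_large {p r : ℕ} {d : JumpData} (hd : d ∈ jumpData p r) :
    d.small + d.large = p + r := by
  obtain ⟨⟨h1, h2⟩, -⟩ := mem_jumpData.1 hd
  have := List.count_true_add_count_false d.1.1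
  have := List.count_true_add_count_false d.1.2
  unfold JumpData.small JumpData.large
  omega

theorem before_after_spec {p r : ℕ} {d : JumpData} (hd : d ∈ jumpData p r) :
    lefts d.after ++ lefts d.before = d.2.1 ∧ rights d.before ++ rights d.after = d.2.2 ∧
      d.before.map Sum.isLeft = d.1.1 ∧ d.after.map Sum.isLeft = d.1.2 := by
  obtain ⟨-, hl, hr⟩ := mem_jumpData.1 hd
  have h1 := hl.length_eq
  have h2 := hr.length_eq
  unfold JumpData.small at h1
  unfold JumpData.large at h2
  obtain ⟨a1, a2, a3⟩ := shuffle_spec d.1.1 (d.2.1.drop (d.1.2.count true))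
    (d.2.2.take (d.1.1.count false)) (by simp; omega) (by simp; omega)
  obtain ⟨b1, b2, b3⟩ := shuffle_spec d.1.2 (d.2.1.take (d.1.2.count true))
    (d.2.2.drop (d.1.1.count false)) (by simp; omega) (by simp; omega)
  unfold JumpData.before JumpData.after
  exact ⟨by rw [a1, b1, List.take_append_drop], by rw [a2, b2, List.take_append_drop], a3, b3⟩

theorem length_before {p r : ℕ} {d : JumpData} (hd : d ∈ jumpData p r) : d.before.length = p := by
  rw [← (mem_jumpData.1 hd).1.1, ← (before_after_spec hd).2.2.1, List.length_map]

theorem fact_before_after {p r : ℕ} {d : JumpData} (hd : d ∈ jumpData p r) :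
    Fact d.small (lefts d.after ++ lefts d.before) ∧
      Fact d.large (rights d.before ++ rights d.after) := by
  obtain ⟨h1, h2, -⟩ := before_after_spec hd
  rw [h1, h2]
  exact (mem_jumpData.1 hd).2

theorem run_rights_before_le {p r : ℕ} {d : JumpData} (hd : d ∈ jumpData p r) :
    run (rights d.before) d.large ≤ d.large :=
  run_le (fun e he => (fact_before_after hd).2.valid e (by simp [he])) le_rfl

theorem fact_build {p r : ℕ} {d : JumpData} (hd : d ∈ jumpData p r) :
    Fact (p + r + 1) d.build := by
  obtain ⟨hl, hr⟩ := fact_before_after hd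
  rw [← small_add_large hd, show d.small + d.large + 1 = d.large + (d.small + 1) by ring]
  exact Fact.assemble rfl (run_rights_before_le hd) hl hr

/-- The arc in position `p` reveals the gap and its size. The placements can then be inverted, and
the tags recover the two words. -/
theorem build_injOn (p r : ℕ) : Set.InjOn JumpData.build (jumpData p r) := by
  intro d hd d' hd' h
  obtain ⟨hl, hr⟩ := fact_before_after hd
  obtain ⟨hl', hr'⟩ := fact_before_after hd'
  have hlen : (d.before.map (placeL (run (rights d.before) d.large) (d.small + 1))).length =
      (d'.before.map (placeL (run (rights d'.before) d'.large) (d'.small + 1))).length := by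
    rw [List.length_map, List.length_map, length_before hd, length_before hd']
  obtain ⟨h1, h2⟩ := List.append_inj h hlen
  simp only [List.cons.injEq, Prod.mk.injEq] at h2
  obtain ⟨⟨h2, h3⟩, h4⟩ := h2
  have hs : d'.small = d.small := by omega
  rw [← h2, hs] at h1 h4
  rw [hs] at hl'
  have hb := placeL_injOn rfl (fun e he => hl.valid e (by simp [he]))
    (fun e he => hl'.valid e (by simp [he])) h1
  have ha := placeR_injOn rfl (fun e he => hl.valid e (by simp [he]))
    (fun e he => hl'.valid e (by simp [he])) h4
  obtain ⟨e1, e2, e3, e4⟩ := before_after_spec hd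
  obtain ⟨f1, f2, f3, f4⟩ := before_after_spec hd'
  rw [← ha, ← hb] at f1 f2
  rw [← hb] at f3
  rw [← ha] at f4
  exact Sigma.ext (Prod.ext (e3.symm.trans f3) (e4.symm.trans f4))
    (heq_of_eq (Prod.ext (e1.symm.trans f1) (e2.symm.trans f2)))

theorem exists_build_eq {p r : ℕ} {L : List (ℕ × ℕ)} (h : Fact (p + r + 1) L)
    (hne : run (L.take p) (p + r + 1) ≠ run (L.take (p + 1)) (p + r + 1)) :
    ∃ d ∈ jumpData p r, d.build = L := by
  have hp : p < L.length := by rw [h.length_eq]; omega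
  have hL : L.take p ++ L[p] :: L.drop (p + 1) = L := by
    rw [← List.drop_eq_getElem_cons hp, List.take_append_drop]
  rw [List.take_succ_eq_append_getElem hp, run_append, run_cons, run_nil] at hne
  obtain ⟨n, k, m, T₁, T₂, hm, hN, hl₁, hl₂, heq, hl, hr⟩ :=
    exists_assemble_of_hop_ne (hL.symm ▸ h) hne.symm
  have hlen := h.length_eq
  rw [List.length_take] at hl₁
  rw [List.length_drop] at hl₂
  have hk := hl.length_eq
  have hn := hr.length_eq
  simp only [List.length_append] at hk hn
  let d : JumpData := ⟨(T₁.map Sum.isLeft, T₂.map Sum.isLeft),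
    (lefts T₂ ++ lefts T₁, rights T₁ ++ rights T₂)⟩
  have hs : d.small = k := by
    simp only [d, JumpData.small, count_true_isLeft]; omega
  have hlarge : d.large = n := by
    simp only [d, JumpData.large, count_false_isLeft]; omega
  have hd : d ∈ jumpData p r := by
    rw [mem_jumpData, hs, hlarge]
    exact ⟨⟨by simp [d]; omega, by simp [d]; omega⟩, hl, hr⟩
  have hb : d.before = T₁ := by
    simp only [d, JumpData.before, count_true_isLeft, count_false_isLeft, List.drop_left,
      List.take_left]
    exact shuffle_isLeft T₁
  have ha : d.after = T₂ := by
    simp only [d, JumpData.after, count_true_isLeft, count_false_isLeft, List.drop_left,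
      List.take_left]
    exact shuffle_isLeft T₂
  refine ⟨d, hd, ?_⟩
  rw [JumpData.build, hb, ha, hs, hlarge, hm, ← heq, hL]

theorem run_take_build {p r : ℕ} {d : JumpData} (hd : d ∈ jumpData p r) :
    run (d.build.take p) (p + r + 1) =
      run (d.build.take (p + 1)) (p + r + 1) + (d.small + 1) := by
  obtain ⟨hl, hr⟩ := fact_before_after hd
  have hlen : (d.before.map (placeL (run (rights d.before) d.large) (d.small + 1))).length = p := by
    rw [List.length_map, length_before hd]
  have h1 := (run_map_placeL_eq_iff (m := d.small + 1) rfl (run_rights_before_le hd)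
    fun e he => hl.valid e (by simp [he])).2 rfl
  rw [show d.large + (d.small + 1) = p + r + 1 by have := small_add_large hd; omega] at h1
  rw [JumpData.build, assemble, List.take_left' hlen, List.take_append, hlen,
    List.take_of_length_le (by omega), run_append, h1]
  simp [hop]

theorem weight_build {p r : ℕ} {d : JumpData} (hd : d ∈ jumpData p r) :
    weight (p + r + 1) d.build = q ^ d.1.1.count true * t ^ (d.1.2.count true + 1) *
      (weight d.small d.2.1 * weight d.large d.2.2) := by
  obtain ⟨hl, hr⟩ := fact_before_after hd
  obtain ⟨h1, h2, h3, h4⟩ := before_after_spec hd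
  have := weight_assemble (m := d.small + 1) rfl hl hr
  rw [h1, h2, ← count_true_isLeft, h3, ← count_true_isLeft, h4,
    show d.large + (d.small + 1) = p + r + 1 by have := small_add_large hd; omega] at this
  exact this

/-- `JumpData.build` is a bijection onto the factorizations that jump at time `p`, and the size of
the jump is `d.small + 1`. -/
theorem sum_jump (p r : ℕ) :
    ∑ L ∈ factFinset (p + r + 1), ((run (L.take p) (p + r + 1) : Coeff) -
        (run (L.take (p + 1)) (p + r + 1) : Coeff)) * weight (p + r + 1) L =
      ∑ s ∈ bools p, ∑ s' ∈ bools r, ((s.count true + s'.count true + 1 : ℕ) : Coeff) *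
        (q ^ s.count true * t ^ (s'.count true + 1) * (F (s.count true + s'.count true) *
          F (s.count false + s'.count false))) := by
  rw [← Finset.sum_product']
  have : ∀ s : List Bool × List Bool,
      ((s.1.count true + s.2.count true + 1 : ℕ) : Coeff) *
        (q ^ s.1.count true * t ^ (s.2.count true + 1) * (F (s.1.count true + s.2.count true) *
          F (s.1.count false + s.2.count false))) =
      ∑ x ∈ factFinset (s.1.count true + s.2.count true) ×ˢ
          factFinset (s.1.count false + s.2.count false),
        ((s.1.count true + s.2.count true + 1 : ℕ) : Coeff) *
        (q ^ s.1.count true * t ^ (s.2.count true + 1) *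
          (weight (s.1.count true + s.2.count true) x.1 *
            weight (s.1.count false + s.2.count false) x.2)) := fun s => by
    rw [← Finset.mul_sum, ← Finset.mul_sum, F_eq_sum, F_eq_sum, Finset.sum_mul_sum,
      Finset.sum_product]
  simp_rw [this]
  rw [Finset.sum_sigma']
  symm
  refine Finset.sum_of_injOn JumpData.build (build_injOn p r) ?_ ?_ ?_
  · intro d hd
    exact mem_factFinset.2 (fact_build hd)
  -- Factorizations without a jump at this time contribute zero.
  · intro L hL hnot
    by_cases hne : run (L.take p) (p + r + 1) = run (L.take (p + 1)) (p + r + 1)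
    · rw [hne, sub_self, zero_mul]
    · obtain ⟨d, hd, rfl⟩ := exists_build_eq (mem_factFinset.1 hL) hne
      exact absurd ⟨d, hd, rfl⟩ hnot
  · intro d hd
    rw [weight_build hd, run_take_build hd]
    simp only [JumpData.small, JumpData.large]
    push_cast
    ring

/-! ### The recursion -/

theorem sum_bools_count {M : Type*} [AddCommMonoid M] (n K : ℕ) (hK : n < K) (f : ℕ → M) :
    ∑ s ∈ bools n, f (s.count true) = ∑ j ∈ Finset.range K, n.choose j • f j := by
  induction n generalizing f K with
  | zero =>
    obtain ⟨K, rfl⟩ := Nat.exists_eq_add_of_lt hK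
    rw [zero_add, Finset.sum_range_succ']
    simp [bools]
  | succ n ih =>
    obtain ⟨K, rfl⟩ : ∃ L, K = L + 1 := ⟨K - 1, by omega⟩
    rw [sum_bools_succ]
    simp only [List.count_cons_self, List.count_cons, beq_iff_eq, Bool.false_eq_true, if_false,
      add_zero]
    rw [ih K (by omega) (fun j => f (j + 1)), ih (K + 1) (by omega) f, Finset.sum_range_succ',
      Finset.sum_range_succ']
    simp only [Nat.choose_succ_succ', add_smul, Finset.sum_add_distrib, Nat.choose_zero_right]
    rw [add_assoc]

/-- Inserting `true` between `s` and `s'` gives a word of length `n + 1` with `i + j + 1` letters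
`true`, in which the inserted one is the `(i + 1)`-st; so the pairs correspond to such words. The
bounds `K` and `L` may be generous, because the surplus binomials vanish. -/
theorem sum_bools_bools_count {M : Type*} [AddCommMonoid M] (n K L : ℕ) (hK : n < K) (hL : n < L)
    (f : ℕ → ℕ → M) :
    ∑ p ∈ Finset.HasAntidiagonal.antidiagonal n, ∑ s ∈ bools p.1, ∑ s' ∈ bools p.2,
        f (s.count true) (s'.count true) =
      ∑ i ∈ Finset.range K, ∑ j ∈ Finset.range L, (n + 1).choose (i + j + 1) • f i j := by
  induction n generalizing f K L with
  | zero =>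
    obtain ⟨K, rfl⟩ : ∃ L, K = L + 1 := ⟨K - 1, by omega⟩
    obtain ⟨L, rfl⟩ : ∃ K, L = K + 1 := ⟨L - 1, by omega⟩
    rw [Finset.sum_range_succ', Finset.sum_range_succ']
    simp [bools, Nat.choose_eq_zero_of_lt]
  | succ n ih =>
    obtain ⟨K, rfl⟩ : ∃ L, K = L + 1 := ⟨K - 1, by omega⟩
    rw [Finset.Nat.sum_antidiagonal_succ]
    simp only [sum_bools_succ]
    simp only [List.count_cons_self, List.count_cons, beq_iff_eq, Bool.false_eq_true, if_false,
      add_zero, Finset.sum_add_distrib]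
    rw [ih K L (by omega) (by omega) (fun i j => f (i + 1) j),
      ih (K + 1) L (by omega) (by omega) f]
    simp only [Nat.choose_succ_succ' (n + 1), add_smul, Finset.sum_add_distrib]
    rw [← add_assoc]
    congr 1
    rw [Finset.sum_range_succ', add_comm]
    have hb := sum_bools_count (n + 1) L hL (f 0)
    simp only [sum_bools_succ, List.count_cons_self, List.count_cons, beq_iff_eq,
      Bool.false_eq_true, if_false, add_zero] at hb
    simp only [bools, Finset.sum_singleton, List.count_nil, zero_add]
    rw [hb]
    congr 1
    refine Finset.sum_congr rfl fun i _ => Finset.sum_congr rfl fun j _ => ?_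
    rw [show i + 1 + j = i + j + 1 by ring]

/-- The sum telescopes from the start `N + 1` to the end `0`. -/
theorem sum_jumps {N : ℕ} {L : List (ℕ × ℕ)} (h : Fact (N + 1) L) :
    ∑ p ∈ Finset.HasAntidiagonal.antidiagonal N, ((run (L.take p.1) (N + 1) : Coeff) -
      (run (L.take (p.1 + 1)) (N + 1) : Coeff)) = (N + 1 : ℕ) := by
  rw [Finset.Nat.sum_antidiagonal_eq_sum_range_succ_mk,
    Finset.sum_range_sub' (fun p => (run (L.take p) (N + 1) : Coeff))]
  have hL : L.take (N + 1) = L := List.take_of_length_le h.length_eq.le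
  simp [hL, h.run_eq _ le_rfl, cyc]

theorem succ_mul_F (N : ℕ) :
    ((N + 1 : ℕ) : Coeff) * F (N + 1) = ∑ k ∈ Finset.range (N + 1),
      ((N + 1 : ℕ) : Coeff) * (N.choose k * (t * qtNumber (k + 1) * F k * F (N - k))) := by
  have h1 : ((N + 1 : ℕ) : Coeff) * F (N + 1) =
      ∑ p ∈ Finset.HasAntidiagonal.antidiagonal N, ∑ L ∈ factFinset (N + 1),
        ((run (L.take p.1) (N + 1) : Coeff) - (run (L.take (p.1 + 1)) (N + 1) : Coeff)) *
          weight (N + 1) L := by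
    rw [Finset.sum_comm, F_eq_sum, Finset.mul_sum]
    refine Finset.sum_congr rfl fun L hL => ?_
    rw [← Finset.sum_mul, sum_jumps (mem_factFinset.1 hL)]
  have h2 : ((N + 1 : ℕ) : Coeff) * F (N + 1) =
      ∑ p ∈ Finset.HasAntidiagonal.antidiagonal N, ∑ s ∈ bools p.1, ∑ s' ∈ bools p.2,
        ((s.count true + s'.count true + 1 : ℕ) : Coeff) *
        (q ^ s.count true * t ^ (s'.count true + 1) * (F (s.count true + s'.count true) *
          F (N - (s.count true + s'.count true)))) := by
    rw [h1]
    refine Finset.sum_congr rfl fun p hp => ?_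
    obtain rfl := Finset.HasAntidiagonal.mem_antidiagonal.1 hp
    rw [sum_jump]
    refine Finset.sum_congr rfl fun s hs => Finset.sum_congr rfl fun s' hs' => ?_
    have e1 := List.count_true_add_count_false s
    have e2 := List.count_true_add_count_false s'
    rw [mem_bools] at hs hs'
    rw [show p.1 + p.2 - (s.count true + s'.count true) = s.count false + s'.count false by omega]
  rw [h2, sum_bools_bools_count N (N + 1) (N + 1) (by omega) (by omega) fun i j =>
    ((i + j + 1 : ℕ) : Coeff) * (q ^ i * t ^ (j + 1) * (F (i + j) * F (N - (i + j))))]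
  -- The binomial vanishes for `i + j > N`; the square becomes a triangle, to be summed along the
  -- diagonals `i + j = k`.
  have h3 : ∀ i ∈ Finset.range (N + 1), ∀ f : ℕ → Coeff,
      ∑ j ∈ Finset.range (N + 1), (N + 1).choose (i + j + 1) • f j =
        ∑ j ∈ Finset.range (N + 1 - i), (N + 1).choose (i + j + 1) • f j := fun i _ f => by
    symm
    refine Finset.sum_subset (Finset.range_mono (by omega)) fun j _ hj => ?_
    rw [Finset.mem_range, not_lt] at hj
    rw [Nat.choose_eq_zero_of_lt (by omega), zero_smul]
  rw [Finset.sum_congr rfl fun i hi => h3 i hi _, ← Finset.sum_range_diag_flip (N + 1) fun i j =>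
    (N + 1).choose (i + j + 1) • (((i + j + 1 : ℕ) : Coeff) *
      (q ^ i * t ^ (j + 1) * (F (i + j) * F (N - (i + j)))))]
  refine Finset.sum_congr rfl fun k _ => ?_
  rw [qtNumber, Finset.mul_sum, Finset.sum_mul, Finset.sum_mul, Finset.mul_sum, Finset.mul_sum]
  refine Finset.sum_congr rfl fun i hi => ?_
  have hik : i + (k - i) = k := by rw [Finset.mem_range] at hi; omega
  have hch : ((N + 1 : ℕ) : Coeff) * N.choose k = (N + 1).choose (k + 1) * (k + 1 : ℕ) := by
    exact_mod_cast Nat.add_one_mul_choose_eq N k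
  rw [hik, nsmul_eq_mul, ← mul_assoc, ← mul_assoc, ← hch, Nat.add_sub_cancel]
  ring

theorem F_succ (N : ℕ) :
    F (N + 1) = ∑ k ∈ Finset.range (N + 1),
      (N.choose k : Coeff) * (t * qtNumber (k + 1) * F k * F (N - k)) := by
  have h := succ_mul_F N
  rw [← Finset.mul_sum] at h
  exact mul_left_cancel₀ (Nat.cast_ne_zero.2 (Nat.succ_ne_zero N)) h

theorem F_zero : F 0 = 1 := by
  have : factFinset 0 = {[]} := by
    ext L
    rw [mem_factFinset, Finset.mem_singleton]
    constructor
    · exact fun h => List.length_eq_zero_iff.1 h.length_eq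
    · rintro rfl
      exact ⟨rfl, by simp, by simp [cyc]⟩
  rw [F_eq_sum, this]
  simp [weight, listAreaL, listAreaU, sumLower, sumUpper]

/-! ### The exponential formula -/

-- This is `F_succ` divided by `N.factorial`, with the binomial coefficient distributed over the two
-- factors.
open PowerSeries in
theorem derivative_egf_F : d⁄dX Coeff (egf F) = egf F * d⁄dX Coeff exponent := by
  ext1 N
  rw [coeff_derivative, mul_comm (egf F), coeff_mul,
    Finset.Nat.sum_antidiagonal_eq_sum_range_succ_mk]
  simp only [coeff_derivative, egf, exponent, coeff_mk, coeff_C_mul, F_succ N, Finset.smul_sum,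
    Finset.sum_mul, Nat.add_sub_cancel]
  refine Finset.sum_congr rfl fun k hk => ?_
  have hk : k ≤ N := by rw [Finset.mem_range] at hk; omega
  simp only [MvPolynomial.smul_eq_C_mul]
  have hc : (MvPolynomial.C (1 / ((N + 1).factorial : ℚ)) : Coeff) * (N.choose k : Coeff) * ((N : Coeff) + 1) =
      (MvPolynomial.C (1 / ((k + 1).factorial : ℚ)) : Coeff) * ((k : Coeff) + 1) *
        MvPolynomial.C (1 / ((N - k).factorial : ℚ)) := by
    set c : ℚ →+* Coeff := MvPolynomial.C
    rw [← map_natCast c (N.choose k),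
      ← map_natCast c N, ← map_natCast c k, ← map_one c]
    simp only [← map_mul, ← map_add]
    congr 1
    have h1 : (N.factorial : ℚ) ≠ 0 := by positivity
    have h2 : (k.factorial : ℚ) ≠ 0 := by positivity
    have h3 : ((N - k).factorial : ℚ) ≠ 0 := by positivity
    rw [Nat.cast_choose ℚ hk, Nat.factorial_succ, Nat.factorial_succ]
    push_cast
    field_simp
  linear_combination (t * qtNumber (k + 1) * F k * F (N - k)) * hc

open PowerSeries in
/-- A power series with vanishing constant term is zero if it satisfies a homogeneous linear
differential equation of order one. -/
theorem eq_zero_of_derivative_eq_mul {R : Type*} [CommRing R] [IsDomain R] [CharZero R]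
    {D E : PowerSeries R} (h : d⁄dX R D = D * E) (h0 : constantCoeff D = 0) : D = 0 := by
  ext1 n
  rw [map_zero]
  induction n using Nat.strong_induction_on with
  | _ n ih =>
  cases n with
  | zero => simpa using h0
  | succ n =>
    have h1 := congrArg (coeff n) h
    -- Coefficient `n` of `D * E` involves only coefficients of `D` up to `n`, which vanish by
    -- induction.
    rw [coeff_derivative, coeff_mul, Finset.sum_eq_zero fun p hp => by
      rw [ih p.1 (by have := Finset.HasAntidiagonal.mem_antidiagonal.1 hp; omega), zero_mul]] at h1
    exact (mul_eq_zero.1 h1).resolve_right (by exact_mod_cast Nat.succ_ne_zero n)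

open PowerSeries in
theorem constantCoeff_exponent : constantCoeff exponent = 0 := by
  simp [exponent, egf, qtNumber]

-- Both sides satisfy the same first-order linear equation and have constant term `1`, so their
-- difference vanishes.
open PowerSeries in
theorem egf_F_eq_exp : egf F = (exp Coeff).subst exponent := by
  refine sub_eq_zero.1 (eq_zero_of_derivative_eq_mul (E := d⁄dX Coeff exponent) ?_ ?_)
  · rw [map_sub, derivative_egf_F, derivative_subst hasSubst_exponent, derivative_exp]
    ring
  · have h : constantCoeff ((exp Coeff).subst exponent : PowerSeries Coeff) = 1 := by
      change MvPowerSeries.constantCoeff ((exp Coeff).subst exponent) = 1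
      rw [constantCoeff_subst hasSubst_exponent, finsum_eq_single _ 0]
      · simp
      · intro d hd
        rw [map_pow]
        change _ • constantCoeff exponent ^ d = 0
        rw [constantCoeff_exponent, zero_pow hd, smul_zero]
    rw [map_sub, h, ← coeff_zero_eq_constantCoeff_apply]
    simp [egf, F_zero]

end MinFact

theorem theorem4p1 :
    (∀ n : ℕ, ∀ f ∈ MinFact.minimalFactorizations n,
      0 ≤ MinFact.areaL f ∧ 0 ≤ MinFact.areaU f) ∧
    MinFact.egf MinFact.F =
      ((PowerSeries.exp MinFact.Coeff).subst MinFact.exponent : PowerSeries MinFact.Coeff) := by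
  refine ⟨fun n f hf => ?_, MinFact.egf_F_eq_exp⟩
  rw [MinFact.areaL_eq, MinFact.areaU_eq]
  exact (MinFact.mem_minimalFactorizations.1 hf).2.area_nonneg
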